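/- Let $\mu$ be a probability measure on $\mathbb R$ that is symmetric about $0$, let $h\sim\mu$, and let $\theta_1$ be in the high temperature regime $0<\theta_1<1/\mathbb E[\operatorname{sech}^2(h)]$. For integers $1\le k\le n$ and a clique $S_0\subseteq\{1,\dots,n\}$ with $|S_0|=k$, the planted random field Curie--Weiss model is the law of $\sigma\in\{-1,1\}^n$ obtained by drawing $h_1,\dots,h_n$ i.i.d. from $\mu$ and then $\sigma$ from $$\mathbb P_{S_0}(\sigma\mid h_1,\dots,h_n)\ \propto\ \exp\Big(\frac{\theta_1}{2k}\Big(\sum_{i\in S_0}\sigma_i\Big)^2+\sum_{i=1}^n h_i\sigma_i\Big).$$ Let $\sigma^{(1)},\dots,\sigma^{(m)}$ be independent observations from this model, each with its own independent field, and for $S\subseteq\{1,\dots,n\}$ with $|S|=k$ put $$\phi_S=\frac1k\Big(\mathbf 1_S^\top\Big(\frac1m\sum_{l=1}^m\sigma^{(l)}\sigma^{(l)\top}\Big)\mathbf 1_S-k\Big).$$ Then there is a constant $C>0$, depending only on $\theta_1$ and $\mu$, such that for every $\varepsilon>0$, whenever $m\ge Ck\log n$, with probability $1-o(1)$ every maximizer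 $S_{\max}$ of $\phi_S$ over the sets $S$ with $|S|=k$ satisfies $$|S_0\,\Delta\,S_{\max}|\le\varepsilon k .$$ Here $o(1)$ tends to $0$ as $k\to\infty$, uniformly over all $n\ge k$, all $m\ge Ck\log n$ and all $S_0$ with $|S_0|=k$ (for fixed $\theta_1$, $\mu$ and $\varepsilon$). -/

import Mathlib

open MeasureTheory

noncomputable section

/-- A spin configuration on `n` sites; `ℤˣ = {1, -1}`. -/
abbrev SpinConfig (n : ℕ) : Type := Fin n → ℤˣ

/-- The real value `± 1` of the spin at site `i`. -/
def spin {n : ℕ} (σ : SpinConfig n) (i : Fin n) : ℝ := ((σ i : ℤ) : ℝ)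

/-- Unnormalised Gibbs weight of the planted random field Curie-Weiss model with clique `S`:
`exp (θ / (2 |S|) * (∑_{i ∈ S} σ_i)^2 + ∑_i h_i σ_i)`. -/
def gibbsWeight {n : ℕ} (θ : ℝ) (S : Finset (Fin n)) (h : Fin n → ℝ) (σ : SpinConfig n) : ℝ :=
  Real.exp (θ / (2 * (S.card : ℝ)) * (∑ i ∈ S, spin σ i) ^ 2 + ∑ i, h i * spin σ i)

/-- Conditional probability of the configuration `σ` given the field `h`. -/
def gibbsProb {n : ℕ} (θ : ℝ) (S : Finset (Fin n)) (h : Fin n → ℝ) (σ : SpinConfig n) : ℝ :=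
  gibbsWeight θ S h σ / ∑ τ : SpinConfig n, gibbsWeight θ S h τ

/-- Probability of `σ` in one observation: the field has i.i.d. coordinates of law `μ`
and is averaged out. -/
def plantedProb {n : ℕ} (θ : ℝ) (μ : Measure ℝ) (S : Finset (Fin n)) (σ : SpinConfig n) : ℝ :=
  ∫ h : Fin n → ℝ, gibbsProb θ S h σ ∂(Measure.pi fun _ : Fin n => μ)

/-- Probability of an event about `m` independent observations, each with its own independent
random field. -/
def sampleProb {n : ℕ} (θ : ℝ) (μ : Measure ℝ) (S : Finset (Fin n)) (m : ℕ)
    (E : Set (Fin m → SpinConfig n)) : ℝ :=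
  ∑ x : Fin m → SpinConfig n, E.indicator (fun y => ∏ l, plantedProb θ μ S (y l)) x

/-- Entry `(i, j)` of the empirical second moment matrix `(1 / m) ∑_l σ^(l) (σ^(l))ᵀ`. -/
def empiricalMoment {n m : ℕ} (x : Fin m → SpinConfig n) (i j : Fin n) : ℝ :=
  (1 / (m : ℝ)) * ∑ l, spin (x l) i * spin (x l) j

/-- The scan statistic `φ_S = (1 / k) (1_Sᵀ Ê[σ σᵀ] 1_S - k)`. -/
def scanStat {n m : ℕ} (k : ℕ) (x : Fin m → SpinConfig n) (S : Finset (Fin n)) : ℝ :=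
  (1 / (k : ℝ)) * ((∑ i ∈ S, ∑ j ∈ S, empiricalMoment x i j) - (k : ℝ))

/-- `S` maximises the scan statistic over all `k`-element subsets of the sites. -/
def IsScanMaximizer {n m : ℕ} (k : ℕ) (x : Fin m → SpinConfig n) (S : Finset (Fin n)) : Prop :=
  S.card = k ∧ ∀ S' : Finset (Fin n), S'.card = k → scanStat k x S' ≤ scanStat k x S

end

open Finset
open scoped BigOperators

/-!
Write `T_A = ∑ i ∈ A, σ i`. A rival `S'` of the clique `S` maximises the scan statistic only if
`∑_r (T_{S'}² - T_S²) ≥ 0` over the observations, so by Chernoff's bound and a union bound over the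
rivals it is enough to have `E exp (s / k * (T_{S'}² - T_S²)) ≤ exp (-c * η)` for one observation,
where `η = #(S' \ S) / k`.

Conditionally on `T_S`, exchangeability makes the spins of `S \ S'` a uniform sample without
replacement from those of the clique, and the symmetry of `μ` makes the spins off the clique
independent fair signs. Linearising the squares by a Gaussian integral and applying Serfling's
inequality, the exponential moment is at most the mean of
`exp (s * η * (-(2 - η) * (X - 1) + O(1 / k) + O(s) * (1 + X)))` with `X = T_S² / k`. It remains to
prove `E (min X L) ≥ 1 + c`. For independent spins of means `tanh (h i)`, averaged over `h`, the
mean of `X` is `1`. The interaction tilts this law by `exp (θ * X / 2)`, which raises the mean by a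
covariance, bounded below through the variance `E (X - X')²` over two replicas sharing the same
field; the products of their spins have mean `∫ tanh² dμ < 1`, so the replicas do not coincide.
-/

section SamplingWithoutReplacement

variable {ι : Type*}

theorem expect_exp_mul_sub_expect_le {S : Finset ι} (hS : S.Nonempty) {f : ι → ℝ} {a b : ℝ}
    (hf : ∀ i ∈ S, f i ∈ Set.Icc a b) (c : ℝ) :
    𝔼 i ∈ S, Real.exp (c * (f i - 𝔼 j ∈ S, f j)) ≤
      Real.exp (c ^ 2 * ((b - a) / 2) ^ 2 / 2) := by
  let _ : MeasurableSpace ι := ⊤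
  let P : Measure ι := (#S : ENNReal)⁻¹ • ∑ i ∈ S, Measure.dirac i
  have hcard : (#S : ENNReal) ≠ 0 := by simp [hS.ne_empty]
  have : IsProbabilityMeasure P :=
    ⟨by simp [P, ENNReal.inv_mul_cancel hcard (ENNReal.natCast_ne_top _)]⟩
  have integral_P (g : ι → ℝ) : ∫ i, g i ∂P = 𝔼 i ∈ S, g i := by
    rw [integral_smul_measure, integral_finsetSum_measure fun _ _ ↦ integrable_dirac (by simp),
      expect_eq_sum_div_card, div_eq_inv_mul]
    simp
  have ae_mem_Icc : ∀ᵐ i ∂P, f i ∈ Set.Icc a b := by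
    refine Measure.ae_smul_measure ?_ _
    rw [ae_finsetSum_measure_iff]
    exact fun i hi ↦ by simpa using hf i hi
  have hmgf := (ProbabilityTheory.hasSubgaussianMGF_of_mem_Icc
    (measurable_from_top (f := f)).aemeasurable ae_mem_Icc).mgf_le c
  rw [ProbabilityTheory.mgf, integral_P, integral_P] at hmgf
  refine hmgf.trans_eq ?_
  simp [div_pow, mul_comm]

theorem expect_erase_powersetCard_insert [DecidableEq ι] (S : Finset ι) (l : ℕ) (G : Finset ι → ℝ) :
    𝔼 i ∈ S, 𝔼 D ∈ (S.erase i).powersetCard l, G (insert i D) =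
      𝔼 D ∈ S.powersetCard (l + 1), G D := by
  have double_count : ∑ i ∈ S, ∑ D ∈ (S.erase i).powersetCard l, G (insert i D) =
      (l + 1 : ℕ) * ∑ D ∈ S.powersetCard (l + 1), G D := calc
    _ = ∑ D ∈ S.powersetCard (l + 1), ∑ _i ∈ D, G D := by
      rw [sum_sigma', sum_sigma']
      refine sum_bij' (fun p _ ↦ ⟨insert p.1 p.2, p.1⟩) (fun p _ ↦ ⟨p.2, p.1.erase p.2⟩)
        ?_ ?_ ?_ ?_ fun _ _ ↦ rfl
      all_goals
        simp only [mem_sigma, mem_powersetCard, Sigma.forall, Sigma.mk.injEq, heq_eq_eq]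
        grind
    _ = _ := by
      rw [mul_sum]
      refine sum_congr rfl fun D hD ↦ ?_
      rw [sum_const, (mem_powersetCard.1 hD).2, nsmul_eq_mul]
  have card_eq : #S * (#S - 1).choose l = (l + 1) * (#S).choose (l + 1) := by
    rcases #S with _ | N
    · simp
    · rw [Nat.add_sub_cancel, Nat.add_one_mul_choose_eq, mul_comm]
  calc _ = 𝔼 i ∈ S, (∑ D ∈ (S.erase i).powersetCard l, G (insert i D)) / (#S - 1).choose l :=
        expect_congr rfl fun i hi ↦ by
          rw [expect_eq_sum_div_card, card_powersetCard, card_erase_of_mem hi]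
    _ = (∑ i ∈ S, ∑ D ∈ (S.erase i).powersetCard l, G (insert i D)) /
        (#S * (#S - 1).choose l : ℕ) := by
        rw [expect_eq_sum_div_card, ← sum_div, div_div, mul_comm, Nat.cast_mul]
    _ = _ := by
        rw [double_count, card_eq, expect_eq_sum_div_card, card_powersetCard, Nat.cast_mul,
          mul_div_mul_left _ _ (by positivity)]

/-- Conditioning on the element `i` of a sample: the rest is a sample from `S.erase i`, and the
change of its mean turns the deviation of `f i` into `(k - l) / k` times itself. -/
theorem sum_insert_sub_mul_expect [DecidableEq ι] {S D : Finset ι} {i : ι} {k l : ℕ}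
    (hS : #S = k + 1) (hi : i ∈ S) (hl : l ≤ k) (hD : i ∉ D) (f : ι → ℝ) :
    ∑ j ∈ insert i D, f j - (l + 1) * 𝔼 j ∈ S, f j =
      (∑ j ∈ D, f j - l * 𝔼 j ∈ S.erase i, f j) +
        (k - l) / k * (f i - 𝔼 j ∈ S, f j) := by
  have hsum : (k + 1) * 𝔼 j ∈ S, f j = f i + k * 𝔼 j ∈ S.erase i, f j := by
    have hcard : #(S.erase i) = k := by rw [card_erase_of_mem hi, hS, Nat.add_sub_cancel]
    have hSsum := card_mul_expect S f
    have hEsum := card_mul_expect (S.erase i) f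
    rw [hS] at hSsum
    rw [hcard] at hEsum
    rw [hEsum, add_sum_erase S f hi, ← hSsum, Nat.cast_add_one]
  rw [sum_insert hD]
  rcases Nat.eq_zero_or_pos k with rfl | hk
  · obtain rfl : l = 0 := by lia
    simp only [Nat.cast_zero] at hsum ⊢
    linear_combination -hsum
  · have : (k : ℝ) ≠ 0 := by positivity
    field_simp
    linear_combination (-l : ℝ) * hsum

theorem expect_erase_exp_sum_insert_eq [DecidableEq ι] {S : Finset ι} {i : ι} {k l : ℕ}
    (hS : #S = k + 1) (hi : i ∈ S) (hl : l ≤ k) (f : ι → ℝ) (c : ℝ) :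
    𝔼 D ∈ (S.erase i).powersetCard l,
        Real.exp (c * (∑ j ∈ insert i D, f j - (l + 1) * 𝔼 j ∈ S, f j)) =
      (𝔼 D ∈ (S.erase i).powersetCard l,
        Real.exp (c * (∑ j ∈ D, f j - l * 𝔼 j ∈ S.erase i, f j))) *
          Real.exp (c * ((k - l) / k) * (f i - 𝔼 j ∈ S, f j)) := by
  rw [expect_mul]
  refine expect_congr rfl fun D hD ↦ ?_
  have hiD : i ∉ D := fun h ↦ by simpa using (mem_powersetCard.1 hD).1 h
  rw [sum_insert_sub_mul_expect hS hi hl hiD, ← Real.exp_add]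
  ring_nf

theorem serfling_variance_step {k l : ℕ} (hl : l ≤ k) :
    (l : ℝ) * (k - l + 1) / k + ((k - l) / k) ^ 2 ≤ (l + 1) * (k - l + 1) / (k + 1) := by
  rcases Nat.eq_zero_or_pos k with rfl | hk
  · obtain rfl : l = 0 := by lia
    simp
  have hkl : (0 : ℝ) ≤ k - l := sub_nonneg.2 (Nat.cast_le.2 hl)
  have hdiff : (l + 1 : ℝ) * (k - l + 1) / (k + 1) -
      (l * (k - l + 1) / k + ((k - l) / k) ^ 2) = (k - l) * l / (k ^ 2 * (k + 1)) := by
    field_simp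
    ring
  have : 0 ≤ (k - l) * l / ((k : ℝ) ^ 2 * (k + 1)) := by positivity
  linarith

/-- Serfling's inequality for sampling without replacement. -/
theorem expect_powersetCard_exp_le {f : ι → ℝ} {a b : ℝ} (c : ℝ) {l : ℕ} {S : Finset ι}
    (hl : l ≤ #S) (hf : ∀ i ∈ S, f i ∈ Set.Icc a b) :
    𝔼 D ∈ S.powersetCard l, Real.exp (c * (∑ i ∈ D, f i - l * 𝔼 j ∈ S, f j)) ≤
      Real.exp (c ^ 2 * (l * (#S - l + 1) / #S) * ((b - a) / 2) ^ 2 / 2) := by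
  classical
  induction l generalizing S with
  | zero => simp
  | succ l ih =>
    obtain ⟨k, hk⟩ : ∃ k, #S = k + 1 := Nat.exists_eq_succ_of_ne_zero (by lia)
    have hlk : l ≤ k := by lia
    have hS : S.Nonempty := card_pos.1 (by lia)
    let x := 𝔼 j ∈ S, f j
    have conditional_bound (i : ι) (hi : i ∈ S) :
        𝔼 D ∈ (S.erase i).powersetCard l,
            Real.exp (c * (∑ j ∈ insert i D, f j - (l + 1) * x)) ≤
          Real.exp (c ^ 2 * (l * (k - l + 1) / k) * ((b - a) / 2) ^ 2 / 2) *
            Real.exp (c * ((k - l) / k) * (f i - x)) := by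
      have hcard : #(S.erase i) = k := by rw [card_erase_of_mem hi, hk, Nat.add_sub_cancel]
      have hih := ih (hlk.trans_eq hcard.symm) fun j hj ↦ hf j (mem_of_mem_erase hj)
      rw [hcard] at hih
      rw [expect_erase_exp_sum_insert_eq hk hi hlk]
      exact mul_le_mul_of_nonneg_right hih (Real.exp_nonneg _)
    calc _ = 𝔼 i ∈ S, 𝔼 D ∈ (S.erase i).powersetCard l,
          Real.exp (c * (∑ j ∈ insert i D, f j - (l + 1) * x)) := by
          rw [expect_erase_powersetCard_insert S l
            fun D ↦ Real.exp (c * (∑ j ∈ D, f j - (l + 1) * x)), Nat.cast_add_one]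
      _ ≤ Real.exp (c ^ 2 * (l * (k - l + 1) / k) * ((b - a) / 2) ^ 2 / 2) *
          Real.exp ((c * ((k - l) / k)) ^ 2 * ((b - a) / 2) ^ 2 / 2) := by
          refine (expect_le_expect conditional_bound).trans ?_
          rw [← mul_expect]
          gcongr
          exact expect_exp_mul_sub_expect_le hS hf _
      _ = Real.exp (c ^ 2 * (l * (k - l + 1) / k + ((k - l) / k) ^ 2) *
          ((b - a) / 2) ^ 2 / 2) := by
          rw [← Real.exp_add]
          ring_nf
      _ ≤ Real.exp (c ^ 2 * ((l + 1) * (k - l + 1) / (k + 1)) * ((b - a) / 2) ^ 2 / 2) := by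
          gcongr
          exact serfling_variance_step hlk
      _ = _ := by
          rw [hk]
          push_cast
          ring_nf

end SamplingWithoutReplacement

section GaussianLinearization

theorem exp_neg_mul_sq_add_mul_eq {b : ℝ} (hb : b ≠ 0) (d z : ℝ) :
    Real.exp (-b * z ^ 2 + d * z) =
      Real.exp (-b * (z - d / (2 * b)) ^ 2) * Real.exp (d ^ 2 / (4 * b)) := by
  rw [← Real.exp_add]
  congr 1
  field_simp
  ring

theorem integrable_exp_neg_mul_sq_add_mul {b : ℝ} (hb : 0 < b) (d : ℝ) :
    Integrable fun z : ℝ ↦ Real.exp (-b * z ^ 2 + d * z) := by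
  simp_rw [exp_neg_mul_sq_add_mul_eq hb.ne']
  exact ((integrable_exp_neg_mul_sq hb).comp_sub_right (d / (2 * b))).mul_const _

theorem integral_exp_neg_mul_sq_add_mul {b : ℝ} (hb : 0 < b) (d : ℝ) :
    ∫ z : ℝ, Real.exp (-b * z ^ 2 + d * z) = √(Real.pi / b) * Real.exp (d ^ 2 / (4 * b)) := by
  simp_rw [exp_neg_mul_sq_add_mul_eq hb.ne']
  rw [integral_mul_const,
    integral_sub_right_eq_self (fun z : ℝ ↦ Real.exp (-b * z ^ 2)) (d / (2 * b)),
    integral_gaussian]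

/-- Hubbard–Stratonovich: the integrand is the exponential of a linear function of `y`, so an
exponential moment of `y ^ 2` is reduced to exponential moments of `y`. -/
theorem integral_exp_neg_sq_add_linear_mul {t : ℝ} (ht : 0 ≤ t) (c y : ℝ) :
    ∫ z : ℝ, Real.exp (-z ^ 2 + (2 * √t * z + c) * y) =
      √Real.pi * Real.exp (t * y ^ 2 + c * y) := by
  have hsplit (z : ℝ) : Real.exp (-z ^ 2 + (2 * √t * z + c) * y) =
      Real.exp (-1 * z ^ 2 + 2 * √t * y * z) * Real.exp (c * y) := by
    rw [← Real.exp_add]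
    ring_nf
  simp_rw [hsplit]
  rw [integral_mul_const, integral_exp_neg_mul_sq_add_mul one_pos, div_one, mul_assoc,
    ← Real.exp_add, mul_pow, mul_pow, Real.sq_sqrt ht]
  ring_nf

theorem integrable_exp_neg_sq_add_linear_mul (a c y : ℝ) :
    Integrable fun z : ℝ ↦ Real.exp (-z ^ 2 + (a * z + c) * y) := by
  refine ((integrable_exp_neg_mul_sq_add_mul one_pos (a * y)).mul_const
    (Real.exp (c * y))).congr (.of_forall fun z ↦ ?_)
  simp only [← Real.exp_add]
  ring_nf

theorem expect_exp_sq_add_mul_le {ι : Type*} {A : Finset ι} {g : ι → ℝ} {v t : ℝ}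
    (ht : 0 ≤ t) (hvt : 2 * t * v < 1)
    (hmgf : ∀ c : ℝ, 𝔼 i ∈ A, Real.exp (c * g i) ≤ Real.exp (c ^ 2 * v / 2)) (c : ℝ) :
    𝔼 i ∈ A, Real.exp (t * g i ^ 2 + c * g i) ≤
      1 / √(1 - 2 * t * v) * Real.exp (c ^ 2 * v / (2 * (1 - 2 * t * v))) := by
  set b := 1 - 2 * t * v with hb
  have hb0 : 0 < b := sub_pos.2 hvt
  have hsq : √t ^ 2 = t := Real.sq_sqrt ht
  have pointwise (z : ℝ) : 𝔼 i ∈ A, Real.exp (-z ^ 2 + (2 * √t * z + c) * g i) ≤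
      Real.exp (-b * z ^ 2 + 2 * √t * c * v * z) * Real.exp (c ^ 2 * v / 2) := calc
    _ = Real.exp (-z ^ 2) * 𝔼 i ∈ A, Real.exp ((2 * √t * z + c) * g i) := by
      simp_rw [mul_expect, Real.exp_add]
    _ ≤ Real.exp (-z ^ 2) * Real.exp ((2 * √t * z + c) ^ 2 * v / 2) := by
      gcongr
      exact hmgf _
    _ = _ := by
      rw [← Real.exp_add, ← Real.exp_add, hb]
      congr 1
      linear_combination 2 * z ^ 2 * v * hsq
  have integrable_term (i : ι) :
      Integrable fun z : ℝ ↦ Real.exp (-z ^ 2 + (2 * √t * z + c) * g i) :=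
    integrable_exp_neg_sq_add_linear_mul _ _ _
  have hpi : 0 < √Real.pi := Real.sqrt_pos.2 Real.pi_pos
  refine le_of_mul_le_mul_left ?_ hpi
  calc _ = ∫ z : ℝ, 𝔼 i ∈ A, Real.exp (-z ^ 2 + (2 * √t * z + c) * g i) := by
        simp_rw [expect_eq_sum_div_card, integral_div,
          integral_finsetSum _ fun i _ ↦ integrable_term i,
          integral_exp_neg_sq_add_linear_mul ht, ← mul_sum, mul_div_assoc]
    _ ≤ ∫ z : ℝ, Real.exp (-b * z ^ 2 + 2 * √t * c * v * z) * Real.exp (c ^ 2 * v / 2) := by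
        refine integral_mono ?_ ((integrable_exp_neg_mul_sq_add_mul hb0 _).mul_const _) pointwise
        simp_rw [expect_eq_sum_div_card]
        exact (integrable_finsetSum _ fun i _ ↦ integrable_term i).div_const _
    _ = √Real.pi * (1 / √b * Real.exp (c ^ 2 * v / (2 * b))) := by
        rw [integral_mul_const, integral_exp_neg_mul_sq_add_mul hb0, Real.sqrt_div Real.pi_pos.le,
          mul_assoc, ← Real.exp_add, div_eq_mul_one_div, mul_assoc]
        congr 3
        field_simp
        linear_combination 8 * c ^ 2 * v ^ 2 * hsq + 4 * c ^ 2 * v * hb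

theorem one_div_sqrt_one_sub_le {u : ℝ} (h0 : 0 ≤ u) (h1 : u ≤ 1 / 2) :
    1 / √(1 - u) ≤ Real.exp (u / 2 + u ^ 2 / 2) := by
  have hpos : 0 < 1 - u := by linarith
  rw [div_le_iff₀ (Real.sqrt_pos.2 hpos),
    show u / 2 + u ^ 2 / 2 = (u + u ^ 2) / 2 by ring, Real.exp_half,
    ← Real.sqrt_mul (Real.exp_nonneg _), Real.one_le_sqrt]
  have hexp := Real.quadratic_le_exp_of_nonneg (show 0 ≤ u + u ^ 2 by positivity)
  nlinarith [mul_le_mul_of_nonneg_right hexp hpos.le, mul_nonneg h0 h0,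
    mul_nonneg (mul_nonneg h0 h0) (sub_nonneg.2 h1)]

end GaussianLinearization

section RandomSigns

variable {n : ℕ}

theorem spin_eq_one_or_neg_one (σ : SpinConfig n) (i : Fin n) : spin σ i = 1 ∨ spin σ i = -1 := by
  rcases Int.units_eq_one_or (σ i) with h | h <;> simp [spin, h]

theorem spin_sq (σ : SpinConfig n) (i : Fin n) : spin σ i ^ 2 = 1 := by
  rcases spin_eq_one_or_neg_one σ i with h | h <;> simp [h]

theorem spin_mem_Icc (σ : SpinConfig n) (i : Fin n) : spin σ i ∈ Set.Icc (-1 : ℝ) 1 := by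
  rcases spin_eq_one_or_neg_one σ i with h | h <;> simp [h]

theorem spin_mul (σ τ : SpinConfig n) (i : Fin n) : spin (σ * τ) i = spin σ i * spin τ i := by
  simp [spin]

/-- The sum of the spins over `S`; its square is the quantity maximised by the scan statistic. -/
noncomputable def totalSpin (S : Finset (Fin n)) (σ : SpinConfig n) : ℝ := ∑ i ∈ S, spin σ i

/-- The squared total spin over `S`, normalised to have mean `1` under independent fair spins.
It is `0` when `S` is empty. -/
noncomputable def sqMagnetization (S : Finset (Fin n)) (σ : SpinConfig n) : ℝ :=
  totalSpin S σ ^ 2 / #S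

/-- The density, relative to independent fair spins, of independent spins with means `a i`. It is
a nonnegative function only if `|a i| ≤ 1` for all `i`. -/
noncomputable def signDensity (a : Fin n → ℝ) (σ : SpinConfig n) : ℝ := ∏ i, (1 + a i * spin σ i)

theorem sqMagnetization_nonneg (S : Finset (Fin n)) (σ : SpinConfig n) :
    0 ≤ sqMagnetization S σ := by
  unfold sqMagnetization
  positivity

theorem expect_prod_spin (φ : Fin n → ℝ → ℝ) :
    𝔼 σ : SpinConfig n, ∏ i, φ i (spin σ i) = ∏ i, (φ i 1 + φ i (-1)) / 2 := by
  have sum_units (i : Fin n) : ∑ u : ℤˣ, φ i ((u : ℤ) : ℝ) = φ i 1 + φ i (-1) := by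
    simp [UnitsInt.univ]
  rw [Fintype.expect_eq_sum_div_card, prod_div_distrib, ← prod_congr rfl fun i _ ↦ sum_units i,
    prod_univ_sum, Fintype.piFinset_univ]
  simp [spin]

theorem expect_exp_mul_totalSpin (B : Finset (Fin n)) (c : ℝ) :
    𝔼 ε : SpinConfig n, Real.exp (c * totalSpin B ε) = Real.cosh c ^ #B := by
  have hprod (ε : SpinConfig n) : Real.exp (c * totalSpin B ε) =
      ∏ i, if i ∈ B then Real.exp (c * spin ε i) else 1 := by
    rw [totalSpin, mul_sum, Real.exp_sum, prod_ite_mem, univ_inter]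
  simp_rw [hprod]
  rw [expect_prod_spin fun i x ↦ if i ∈ B then Real.exp (c * x) else 1]
  calc _ = ∏ i, if i ∈ B then Real.cosh c else 1 := by
        refine prod_congr rfl fun i _ ↦ ?_
        split_ifs <;> simp [Real.cosh_eq]
    _ = _ := by rw [prod_ite_mem, univ_inter, prod_const]

theorem expect_exp_mul_totalSpin_le (B : Finset (Fin n)) (c : ℝ) :
    𝔼 ε : SpinConfig n, Real.exp (c * totalSpin B ε) ≤ Real.exp (c ^ 2 * #B / 2) := calc
  _ = Real.cosh c ^ #B := expect_exp_mul_totalSpin B c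
  _ ≤ Real.exp (c ^ 2 / 2) ^ #B := by
    gcongr
    exact Real.cosh_le_exp_half_sq c
  _ = _ := by
    rw [← Real.exp_nat_mul]
    ring_nf

theorem expect_signDensity_mul_prod_spin (a : Fin n → ℝ) (A : Finset (Fin n)) :
    𝔼 σ, signDensity a σ * ∏ i ∈ A, spin σ i = ∏ i ∈ A, a i := by
  have hprod (σ : SpinConfig n) : signDensity a σ * ∏ i ∈ A, spin σ i =
      ∏ i, (1 + a i * spin σ i) * if i ∈ A then spin σ i else 1 := by
    rw [signDensity, prod_mul_distrib, prod_ite_mem, univ_inter]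
  simp_rw [hprod]
  rw [expect_prod_spin fun i x ↦ (1 + a i * x) * if i ∈ A then x else 1]
  calc _ = ∏ i, if i ∈ A then a i else 1 := by
        refine prod_congr rfl fun i _ ↦ ?_
        split_ifs <;> ring
    _ = _ := by rw [prod_ite_mem, univ_inter]

theorem expect_signDensity (a : Fin n → ℝ) : 𝔼 σ, signDensity a σ = 1 := by
  simpa using expect_signDensity_mul_prod_spin a ∅

theorem expect_signDensity_mul_spin_mul_spin (a : Fin n → ℝ) (i j : Fin n) :
    𝔼 σ, signDensity a σ * (spin σ i * spin σ j) = if i = j then 1 else a i * a j := by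
  split_ifs with hij
  · simp [hij, ← sq, spin_sq, expect_signDensity]
  · simpa [prod_pair hij] using expect_signDensity_mul_prod_spin a {i, j}

theorem expect_signDensity_mul_sq_totalSpin (a : Fin n → ℝ) (A : Finset (Fin n)) :
    𝔼 σ, signDensity a σ * totalSpin A σ ^ 2 = (∑ i ∈ A, a i) ^ 2 + ∑ i ∈ A, (1 - a i ^ 2) := by
  have hcov (i j : Fin n) : (if i = j then 1 else a i * a j) =
      a i * a j + if i = j then 1 - a i ^ 2 else 0 := by
    split_ifs with hij
    · rw [hij]
      ring
    · ring
  simp_rw [totalSpin, sq (∑ i ∈ A, spin _ i), sum_mul_sum, mul_sum, expect_sum_comm,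
    expect_signDensity_mul_spin_mul_spin, hcov, sum_add_distrib, sum_ite_eq]
  rw [← sum_mul_sum, ← sq, sum_congr rfl fun i hi ↦ if_pos hi]

theorem expect_spin_mul_spin (i j : Fin n) :
    𝔼 σ : SpinConfig n, spin σ i * spin σ j = if i = j then 1 else 0 := by
  simpa [signDensity] using expect_signDensity_mul_spin_mul_spin 0 i j

theorem expect_linear_mul_linear (A : Finset (Fin n)) (a b : Fin n → ℝ) :
    𝔼 σ : SpinConfig n, (∑ i ∈ A, a i * spin σ i) * ∑ i ∈ A, b i * spin σ i =
      ∑ i ∈ A, a i * b i := by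
  simp_rw [sum_mul_sum, expect_sum_comm, mul_mul_mul_comm, ← mul_expect, expect_spin_mul_spin,
    mul_ite, mul_one, mul_zero, sum_ite_eq]
  exact sum_congr rfl fun i hi ↦ if_pos hi

theorem expect_spin_mul_eq_zero {i : Fin n} {F : SpinConfig n → ℝ} (hF : DependsOn F {i}ᶜ) :
    𝔼 σ, spin σ i * F σ = 0 := by
  let flip : SpinConfig n := Pi.mulSingle i (-1)
  have F_flip (σ : SpinConfig n) : F (flip * σ) = F σ := hF fun j hj ↦ by
    simp [flip, Pi.mulSingle_eq_of_ne (Set.mem_compl_singleton_iff.1 hj)]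
  have spin_flip (σ : SpinConfig n) : spin (flip * σ) i = -spin σ i := by
    simp [spin, flip]
  have hneg : 𝔼 σ, spin σ i * F σ = 𝔼 σ, -(spin σ i * F σ) :=
    (Fintype.expect_equiv (Equiv.mulLeft flip) _ _ fun σ ↦ by
      rw [Equiv.coe_mulLeft, F_flip, spin_flip, neg_mul]).symm
  rw [expect_neg_distrib] at hneg
  linarith

theorem expect_sq_mul_sq (A : Finset (Fin n)) (a b : Fin n → ℝ) :
    𝔼 σ : SpinConfig n, (∑ i ∈ A, a i * spin σ i) ^ 2 * (∑ i ∈ A, b i * spin σ i) ^ 2 =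
      (∑ i ∈ A, a i ^ 2) * (∑ i ∈ A, b i ^ 2) + 2 * (∑ i ∈ A, a i * b i) ^ 2 -
        2 * ∑ i ∈ A, a i ^ 2 * b i ^ 2 := by
  induction A using Finset.induction_on with
  | empty => simp
  | insert i A hi ih =>
    set M : SpinConfig n → ℝ := fun σ ↦ ∑ j ∈ A, a j * spin σ j
    set N : SpinConfig n → ℝ := fun σ ↦ ∑ j ∈ A, b j * spin σ j
    have expand (σ : SpinConfig n) :
        (∑ j ∈ insert i A, a j * spin σ j) ^ 2 * (∑ j ∈ insert i A, b j * spin σ j) ^ 2 =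
          M σ ^ 2 * N σ ^ 2 + b i ^ 2 * (M σ * M σ) + a i ^ 2 * (N σ * N σ) +
            4 * (a i * b i) * (M σ * N σ) + a i ^ 2 * b i ^ 2 +
            spin σ i * (2 * a i * M σ * N σ ^ 2 + 2 * b i * M σ ^ 2 * N σ +
              2 * a i ^ 2 * b i * N σ + 2 * a i * b i ^ 2 * M σ) := by
      rw [sum_insert hi, sum_insert hi]
      change (a i * spin σ i + M σ) ^ 2 * (b i * spin σ i + N σ) ^ 2 = _
      rcases spin_eq_one_or_neg_one σ i with h | h <;> rw [h] <;> ring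
    have odd_part : 𝔼 σ, spin σ i * (2 * a i * M σ * N σ ^ 2 + 2 * b i * M σ ^ 2 * N σ +
        2 * a i ^ 2 * b i * N σ + 2 * a i * b i ^ 2 * M σ) = 0 := by
      refine expect_spin_mul_eq_zero fun σ ρ hσρ ↦ ?_
      have spin_eq (j : Fin n) (hj : j ∈ A) : spin σ j = spin ρ j := by
        rw [spin, spin, hσρ j (ne_of_mem_of_not_mem hj hi)]
      have hM : M σ = M ρ := sum_congr rfl fun j hj ↦ by rw [spin_eq j hj]
      have hN : N σ = N ρ := sum_congr rfl fun j hj ↦ by rw [spin_eq j hj]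
      simp only [hM, hN]
    simp only [expand, expect_add_distrib, ← mul_expect]
    rw [odd_part, ih, expect_linear_mul_linear, expect_linear_mul_linear,
      expect_linear_mul_linear, Fintype.expect_const, sum_insert hi, sum_insert hi, sum_insert hi,
      sum_insert hi]
    simp only [← sq]
    ring

theorem expect_sqMagnetization {S : Finset (Fin n)} (hS : S.Nonempty) :
    𝔼 σ, sqMagnetization S σ = 1 := by
  have hcard : (#S : ℝ) ≠ 0 := by simp [hS.ne_empty]
  have h := expect_linear_mul_linear S (fun _ ↦ 1) (fun _ ↦ 1)
  simp only [one_mul, ← sq, sum_const, nsmul_eq_mul, mul_one, one_pow] at h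
  simp_rw [sqMagnetization, ← expect_div, totalSpin, h]
  exact div_self hcard

theorem expect_sqMagnetization_mul_sqMagnetization_mul {S : Finset (Fin n)} (hS : S.Nonempty)
    (e : SpinConfig n) :
    𝔼 σ, sqMagnetization S σ * sqMagnetization S (e * σ) =
      1 - 2 / #S + 2 * (totalSpin S e / #S) ^ 2 := by
  have hcard : (#S : ℝ) ≠ 0 := by simp [hS.ne_empty]
  have h := expect_sq_mul_sq S (fun _ ↦ 1) (spin e)
  simp only [one_mul, spin_sq, sum_const, nsmul_eq_mul, mul_one, one_pow] at h
  simp_rw [sqMagnetization, totalSpin, spin_mul, div_mul_div_comm, ← expect_div, h]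
  field_simp
  ring

theorem expect_sq_sqMagnetization {S : Finset (Fin n)} (hS : S.Nonempty) :
    𝔼 σ, sqMagnetization S σ ^ 2 = 3 - 2 / #S := by
  have hcard : (#S : ℝ) ≠ 0 := by simp [hS.ne_empty]
  have h := expect_sqMagnetization_mul_sqMagnetization_mul hS 1
  simp only [one_mul, ← sq] at h
  rw [h, totalSpin]
  simp [spin, hcard]
  ring

theorem expect_sqMagnetization_pow_three_le {S : Finset (Fin n)} (hS : S.Nonempty) :
    𝔼 σ, sqMagnetization S σ ^ 3 ≤ 2880 := by
  have hcard : (0 : ℝ) < #S := by simpa using hS.card_pos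
  set c : ℝ := 1 / √(#S : ℝ) with hc
  have hc_sq : c ^ 2 * #S = 1 := by
    rw [hc, div_pow, Real.sq_sqrt hcard.le]
    field_simp
  have pointwise (σ : SpinConfig n) : sqMagnetization S σ ^ 3 ≤
      720 * (Real.exp (c * totalSpin S σ) + Real.exp (-c * totalSpin S σ)) := by
    have hX : sqMagnetization S σ ^ 3 = |c * totalSpin S σ| ^ 6 := by
      rw [show 6 = 2 * 3 from rfl, pow_mul, sq_abs, mul_pow, sqMagnetization,
        eq_div_of_mul_eq hcard.ne' hc_sq]
      ring
    have hpow := Real.pow_div_factorial_le_exp _ (abs_nonneg (c * totalSpin S σ)) 6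
    rw [div_le_iff₀ (by positivity), show (Nat.factorial 6 : ℝ) = 720 by norm_num [Nat.factorial]]
      at hpow
    rw [hX, neg_mul]
    linarith [Real.exp_abs_le (c * totalSpin S σ)]
  have exp_half_le : Real.exp (1 / 2) ≤ 2 := by
    rw [← Real.le_log_iff_exp_le two_pos]
    linarith [Real.log_two_gt_d9]
  have mgf_pos := expect_exp_mul_totalSpin_le S c
  have mgf_neg := expect_exp_mul_totalSpin_le S (-c)
  rw [neg_sq] at mgf_neg
  rw [hc_sq] at mgf_pos mgf_neg
  refine (expect_le_expect fun σ _ ↦ pointwise σ).trans ?_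
  rw [← mul_expect, expect_add_distrib]
  linarith

end RandomSigns

section Exchange

variable {n : ℕ}

theorem expect_exp_mul_exchange_le (σ : SpinConfig n) {S B : Finset (Fin n)} (hBS : #B ≤ #S)
    (c : ℝ) :
    𝔼 ε : SpinConfig n, 𝔼 D ∈ S.powersetCard #B,
        Real.exp (c * (totalSpin B ε - (totalSpin D σ - #B * (totalSpin S σ / #S)))) ≤
      Real.exp (c ^ 2 * (#B + #B * (#S - #B + 1) / #S) / 2) := by
  have hD := expect_powersetCard_exp_le (-c) hBS fun i _ ↦ spin_mem_Icc σ i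
  rw [expect_eq_sum_div_card (s := S)] at hD
  calc _ = (𝔼 ε : SpinConfig n, Real.exp (c * totalSpin B ε)) * 𝔼 D ∈ S.powersetCard #B,
          Real.exp (-c * (totalSpin D σ - #B * (totalSpin S σ / #S))) := by
        simp_rw [expect_mul_expect, ← Real.exp_add, neg_mul, ← sub_eq_add_neg, ← mul_sub]
    _ ≤ Real.exp (c ^ 2 * #B / 2) *
          Real.exp ((-c) ^ 2 * (#B * (#S - #B + 1) / #S) * ((1 - -1) / 2) ^ 2 / 2) := by
        gcongr
        · exact expect_exp_mul_totalSpin_le B c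
        · exact hD
    _ = _ := by
        rw [← Real.exp_add]
        ring_nf

theorem exp_neg_mul_gaussian_factor_le {k s η x : ℝ} (hk : 1 ≤ k) (hη0 : 0 ≤ η) (hη1 : η ≤ 1)
    (hs : 0 ≤ s) (hs' : s ≤ 1 / 12) {u : ℝ} (hu : u = 2 * (s * η) * (2 - η + 1 / k)) :
    Real.exp (-(s * η * (2 - η) * (k * x ^ 2))) * (1 / √(1 - u) * Real.exp
        ((2 * s * (1 - η) * x) ^ 2 * (η * k * (2 - η + 1 / k)) / (2 * (1 - u)))) ≤
      Real.exp (s * η * (-(2 - η) * (k * x ^ 2 - 1) + 1 / k + 18 * s + 12 * s * (k * x ^ 2))) := by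
  have hk_inv : 1 / k ≤ 1 := by rwa [div_le_one (by linarith)]
  have hk_inv0 : 0 ≤ 1 / k := by positivity
  have hsη : 0 ≤ s * η := by positivity
  have hu0 : 0 ≤ u := by
    rw [hu]
    exact mul_nonneg (by positivity) (by linarith)
  have hu6 : u ≤ 6 * (s * η) := by
    rw [hu]
    nlinarith
  have hsη_le : s * η ≤ s := mul_le_of_le_one_right hs hη1
  have hu_half : u ≤ 1 / 2 := by linarith
  have hu_sq : u ^ 2 ≤ 36 * s * (s * η) := calc
    u ^ 2 ≤ (6 * (s * η)) ^ 2 := by gcongr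
    _ = 36 * (s * η) * (s * η) := by ring
    _ ≤ 36 * s * (s * η) := by gcongr
  have cross_term_le : (2 * s * (1 - η) * x) ^ 2 * (η * k * (2 - η + 1 / k)) ≤
      12 * s * (s * η) * (k * x ^ 2) := calc
    _ = 4 * s * (s * η) * (k * x ^ 2) * ((1 - η) ^ 2 * (2 - η + 1 / k)) := by ring
    _ ≤ 4 * s * (s * η) * (k * x ^ 2) * (1 * 3) := by
      gcongr
      · linarith
      · nlinarith
      · linarith
    _ = _ := by ring
  have exponent_le : (2 * s * (1 - η) * x) ^ 2 * (η * k * (2 - η + 1 / k)) / (2 * (1 - u)) ≤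
      12 * s * (s * η) * (k * x ^ 2) := by
    rw [div_le_iff₀ (by linarith)]
    exact cross_term_le.trans (le_mul_of_one_le_right (by positivity) (by linarith))
  calc _ ≤ Real.exp (-(s * η * (2 - η) * (k * x ^ 2))) * (Real.exp (u / 2 + u ^ 2 / 2) *
        Real.exp (12 * s * (s * η) * (k * x ^ 2))) := by
        gcongr
        exact one_div_sqrt_one_sub_le hu0 hu_half
    _ ≤ _ := by
        rw [← Real.exp_add, ← Real.exp_add, Real.exp_le_exp]
        linarith

theorem expect_exp_sq_sub_sq_le_of_mgf_le {Ω : Type*} {A : Finset Ω} {g : Ω → ℝ} {k s η : ℝ}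
    (hk : 1 ≤ k) (hη0 : 0 ≤ η) (hη1 : η ≤ 1) (hs : 0 ≤ s) (hs' : s ≤ 1 / 12)
    (hg : ∀ c : ℝ, 𝔼 ω ∈ A, Real.exp (c * g ω) ≤
      Real.exp (c ^ 2 * (η * k * (2 - η + 1 / k)) / 2)) (x : ℝ) :
    𝔼 ω ∈ A, Real.exp (s / k * (((1 - η) * (k * x) + g ω) ^ 2 - (k * x) ^ 2)) ≤
      Real.exp (s * η * (-(2 - η) * (k * x ^ 2 - 1) + 1 / k + 18 * s + 12 * s * (k * x ^ 2))) := by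
  set u : ℝ := 2 * (s * η) * (2 - η + 1 / k)
  have hu : 2 * (s / k) * (η * k * (2 - η + 1 / k)) = u := by
    simp only [u]
    field_simp
  have hu_lt : u < 1 := by
    have hk_inv : 1 / k ≤ 1 := by rwa [div_le_one (by linarith)]
    have : s * η ≤ 1 / 12 * 1 := by gcongr
    have : 0 ≤ s * η := by positivity
    simp only [u]
    nlinarith
  have expand (ω : Ω) :
      Real.exp (s / k * (((1 - η) * (k * x) + g ω) ^ 2 - (k * x) ^ 2)) =
        Real.exp (-(s * η * (2 - η) * (k * x ^ 2))) *
          Real.exp (s / k * g ω ^ 2 + 2 * s * (1 - η) * x * g ω) := by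
    rw [← Real.exp_add]
    congr 1
    field_simp
    ring
  have sq_bound := expect_exp_sq_add_mul_le (t := s / k) (by positivity) (hu.trans_lt hu_lt) hg
    (2 * s * (1 - η) * x)
  rw [hu] at sq_bound
  simp_rw [expand, ← mul_expect]
  exact (mul_le_mul_of_nonneg_left sq_bound (Real.exp_nonneg _)).trans
    (exp_neg_mul_gaussian_factor_le hk hη0 hη1 hs hs' rfl)

theorem expect_exchange_exp_le (σ : SpinConfig n) {S B : Finset (Fin n)} (hS : S.Nonempty)
    (hBS : #B ≤ #S) {s : ℝ} (hs : 0 ≤ s) (hs' : s ≤ 1 / 12) {η : ℝ} (hη : η = #B / #S) :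
    𝔼 ε : SpinConfig n, 𝔼 D ∈ S.powersetCard #B,
        Real.exp (s / #S *
          ((totalSpin S σ - totalSpin D σ + totalSpin B ε) ^ 2 - totalSpin S σ ^ 2)) ≤
      Real.exp (s * η * (-(2 - η) * (sqMagnetization S σ - 1) + 1 / #S + 18 * s +
        12 * s * sqMagnetization S σ)) := by
  have hk : (1 : ℝ) ≤ #S := by exact_mod_cast hS.card_pos
  have hk0 : (#S : ℝ) ≠ 0 := by positivity
  have hη0 : 0 ≤ η := hη ▸ by positivity
  have hη1 : η ≤ 1 := hη ▸ div_le_one_of_le₀ (by exact_mod_cast hBS) (by positivity)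
  have hB : (#B : ℝ) = η * #S := by rw [hη, div_mul_cancel₀ _ hk0]
  let x := totalSpin S σ / #S
  have hT : totalSpin S σ = #S * x := (mul_div_cancel₀ _ hk0).symm
  have hX : sqMagnetization S σ = #S * x ^ 2 := by
    rw [sqMagnetization, hT]
    field_simp
  let g (q : SpinConfig n × Finset (Fin n)) : ℝ :=
    totalSpin B q.1 - (totalSpin q.2 σ - #B * x)
  have mgf_le (c : ℝ) : 𝔼 q ∈ univ ×ˢ S.powersetCard #B, Real.exp (c * g q) ≤
      Real.exp (c ^ 2 * (η * #S * (2 - η + 1 / #S)) / 2) := by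
    rw [expect_product]
    refine (expect_exp_mul_exchange_le σ hBS c).trans_eq ?_
    rw [hB]
    field_simp
    ring_nf
  have bound := expect_exp_sq_sub_sq_le_of_mgf_le hk hη0 hη1 hs hs' mgf_le x
  rw [expect_product] at bound
  rw [hX]
  refine Eq.trans_le (expect_congr rfl fun ε _ ↦ expect_congr rfl fun D _ ↦ ?_) bound
  simp only [g, hT, hB]
  ring_nf

end Exchange

section PlantedMean

variable {n : ℕ} {θ : ℝ} {μ : Measure ℝ} {S : Finset (Fin n)}

theorem gibbsWeight_pos (h : Fin n → ℝ) (σ : SpinConfig n) : 0 < gibbsWeight θ S h σ :=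
  Real.exp_pos _

theorem sum_gibbsWeight_pos (h : Fin n → ℝ) : 0 < ∑ σ, gibbsWeight θ S h σ :=
  sum_pos (fun σ _ ↦ gibbsWeight_pos h σ) univ_nonempty

theorem gibbsProb_nonneg (h : Fin n → ℝ) (σ : SpinConfig n) : 0 ≤ gibbsProb θ S h σ :=
  div_nonneg (gibbsWeight_pos h σ).le (sum_gibbsWeight_pos h).le

theorem sum_gibbsProb (h : Fin n → ℝ) : ∑ σ, gibbsProb θ S h σ = 1 := by
  simp_rw [gibbsProb, ← sum_div]
  exact div_self (sum_gibbsWeight_pos h).ne'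

theorem gibbsProb_le_one (h : Fin n → ℝ) (σ : SpinConfig n) : gibbsProb θ S h σ ≤ 1 :=
  sum_gibbsProb (θ := θ) (S := S) h ▸
    single_le_sum (fun ρ _ ↦ gibbsProb_nonneg h ρ) (mem_univ σ)

theorem continuous_gibbsProb (σ : SpinConfig n) :
    Continuous fun h : Fin n → ℝ ↦ gibbsProb θ S h σ := by
  have hw (ρ : SpinConfig n) : Continuous fun h : Fin n → ℝ ↦ gibbsWeight θ S h ρ := by
    unfold gibbsWeight
    fun_prop
  exact (hw σ).div (continuous_finsetSum _ fun ρ _ ↦ hw ρ) fun h ↦ (sum_gibbsWeight_pos h).ne'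

theorem integrable_gibbsProb [IsProbabilityMeasure μ] (σ : SpinConfig n) :
    Integrable (fun h : Fin n → ℝ ↦ gibbsProb θ S h σ) (Measure.pi fun _ ↦ μ) :=
  .of_bound (continuous_gibbsProb σ).aestronglyMeasurable 1 <| .of_forall fun h ↦ by
    rw [Real.norm_of_nonneg (gibbsProb_nonneg h σ)]
    exact gibbsProb_le_one h σ

theorem plantedProb_nonneg (σ : SpinConfig n) : 0 ≤ plantedProb θ μ S σ :=
  integral_nonneg fun h ↦ gibbsProb_nonneg h σ

theorem sum_plantedProb [IsProbabilityMeasure μ] : ∑ σ, plantedProb θ μ S σ = 1 := by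
  simp_rw [plantedProb]
  rw [← integral_finsetSum _ fun σ _ ↦ integrable_gibbsProb σ]
  simp [sum_gibbsProb]

variable (θ μ S) in
/-- The expectation of `F` under the law of one observation of the planted model. -/
noncomputable def plantedMean (F : SpinConfig n → ℝ) : ℝ := ∑ σ, plantedProb θ μ S σ * F σ

theorem plantedMean_mono {F G : SpinConfig n → ℝ} (h : ∀ σ, F σ ≤ G σ) :
    plantedMean θ μ S F ≤ plantedMean θ μ S G :=
  sum_le_sum fun σ _ ↦ mul_le_mul_of_nonneg_left (h σ) (plantedProb_nonneg σ)

theorem plantedMean_const_sub_mul [IsProbabilityMeasure μ] (a b : ℝ) (F : SpinConfig n → ℝ) :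
    plantedMean θ μ S (fun σ ↦ a - b * F σ) = a - b * plantedMean θ μ S F := by
  simp_rw [plantedMean, mul_sub, sum_sub_distrib, ← sum_mul, sum_plantedProb, one_mul, mul_sum,
    mul_left_comm]

theorem expect_plantedMean {ι : Type*} (A : Finset ι) (F : ι → SpinConfig n → ℝ) :
    𝔼 i ∈ A, plantedMean θ μ S (F i) = plantedMean θ μ S fun σ ↦ 𝔼 i ∈ A, F i σ := by
  simp_rw [plantedMean, expect_sum_comm, mul_expect]

theorem plantedMean_eq_integral [IsProbabilityMeasure μ] (F : SpinConfig n → ℝ) :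
    plantedMean θ μ S F = ∫ h, ∑ σ, gibbsProb θ S h σ * F σ ∂(Measure.pi fun _ : Fin n ↦ μ) := by
  rw [integral_finsetSum _ fun σ _ ↦ (integrable_gibbsProb σ).mul_const _]
  simp_rw [plantedMean, plantedProb, integral_mul_const]

theorem plantedMean_comp_equiv {g : SpinConfig n ≃ SpinConfig n} {G : (Fin n → ℝ) → Fin n → ℝ}
    (hG : MeasurePreserving G (Measure.pi fun _ ↦ μ) (Measure.pi fun _ ↦ μ))
    (hgG : ∀ h σ, gibbsWeight θ S (G h) (g σ) = gibbsWeight θ S h σ) (F : SpinConfig n → ℝ) :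
    plantedMean θ μ S (fun σ ↦ F (g σ)) = plantedMean θ μ S F := by
  have gibbsProb_eq (h : Fin n → ℝ) (σ : SpinConfig n) :
      gibbsProb θ S (G h) (g σ) = gibbsProb θ S h σ := by
    simp_rw [gibbsProb, ← g.sum_comp (gibbsWeight θ S (G h)), hgG]
  have plantedProb_eq (σ : SpinConfig n) : plantedProb θ μ S (g σ) = plantedProb θ μ S σ := calc
    _ = ∫ h, gibbsProb θ S (G h) (g σ) ∂(Measure.pi fun _ : Fin n ↦ μ) := by
      rw [plantedProb]
      conv_lhs => rw [← hG.map_eq]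
      exact integral_map hG.measurable.aemeasurable (continuous_gibbsProb _).aestronglyMeasurable
    _ = _ := by simp_rw [gibbsProb_eq, plantedProb]
  simp_rw [plantedMean, ← g.sum_comp fun σ ↦ plantedProb θ μ S σ * F σ, plantedProb_eq]

theorem measurePreserving_spin_mul (hμ : μ.map (fun x : ℝ ↦ -x) = μ) [SigmaFinite μ]
    (e : SpinConfig n) :
    MeasurePreserving (fun (h : Fin n → ℝ) i ↦ spin e i * h i)
      (Measure.pi fun _ ↦ μ) (Measure.pi fun _ ↦ μ) := by
  refine measurePreserving_pi (f := fun i x ↦ spin e i * x) (fun _ ↦ μ) (fun _ ↦ μ) fun i ↦ ?_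
  rcases spin_eq_one_or_neg_one e i with h | h
  · simpa only [h, one_mul] using! MeasurePreserving.id μ
  · simpa only [h, neg_mul, one_mul] using! ⟨measurable_neg, hμ⟩

theorem plantedMean_comp_mul [SigmaFinite μ] (hμ : μ.map (fun x : ℝ ↦ -x) = μ) {e : SpinConfig n}
    (he : ∀ i ∈ S, e i = 1) (F : SpinConfig n → ℝ) :
    plantedMean θ μ S (fun σ ↦ F (e * σ)) = plantedMean θ μ S F := by
  refine plantedMean_comp_equiv (g := Equiv.mulLeft e) (measurePreserving_spin_mul hμ e)
    (fun h σ ↦ ?_) F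
  have clique_eq : ∑ i ∈ S, spin (e * σ) i = ∑ i ∈ S, spin σ i :=
    sum_congr rfl fun i hi ↦ by simp [spin, he i hi]
  have field_eq : ∑ i, spin e i * h i * spin (e * σ) i = ∑ i, h i * spin σ i :=
    sum_congr rfl fun i _ ↦ by
      rw [spin_mul]
      linear_combination (h i * spin σ i) * spin_sq e i
  rw [Equiv.coe_mulLeft, gibbsWeight, gibbsWeight, clique_eq, field_eq]

theorem plantedMean_eq_plantedMean_expect_piecewise [SigmaFinite μ]
    (hμ : μ.map (fun x : ℝ ↦ -x) = μ) (F : SpinConfig n → ℝ) :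
    plantedMean θ μ S F = plantedMean θ μ S fun σ ↦ 𝔼 ε, F (S.piecewise σ ε) := by
  have flip_eq (ε : SpinConfig n) :
      plantedMean θ μ S (fun σ ↦ F (S.piecewise 1 ε * σ)) = plantedMean θ μ S F :=
    plantedMean_comp_mul hμ (fun i hi ↦ by simp [hi]) F
  calc _ = 𝔼 ε, plantedMean θ μ S fun σ ↦ F (S.piecewise 1 ε * σ) := by
        simp_rw [flip_eq, Fintype.expect_const]
    _ = plantedMean θ μ S fun σ ↦ 𝔼 ε, F (S.piecewise 1 ε * σ) := expect_plantedMean _ _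
    _ = _ := by
        congr 1 with σ
        refine Fintype.expect_equiv (Equiv.mulRight σ) _ _ fun ε ↦ congrArg F ?_
        ext i
        by_cases hi : i ∈ S <;> simp [hi]

theorem totalSpin_comp_perm (A : Finset (Fin n)) (σ : SpinConfig n) (π : Equiv.Perm (Fin n)) :
    totalSpin A (σ ∘ π) = totalSpin (A.map π.toEmbedding) σ :=
  (sum_map A π.toEmbedding (spin σ)).symm

theorem plantedMean_comp_perm [SigmaFinite μ] {π : Equiv.Perm (Fin n)}
    (hπ : S.map π.toEmbedding = S) (F : SpinConfig n → ℝ) :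
    plantedMean θ μ S (fun σ ↦ F (σ ∘ π)) = plantedMean θ μ S F := by
  refine plantedMean_comp_equiv (g := Equiv.arrowCongr π.symm (Equiv.refl ℤˣ))
    (measurePreserving_arrowCongr' (fun _ ↦ μ) (fun _ ↦ μ) π.symm (MeasurableEquiv.refl ℝ)
      fun _ ↦ MeasurePreserving.id μ) (fun h σ ↦ ?_) F
  have clique_eq : ∑ i ∈ S, spin (σ ∘ π) i = ∑ i ∈ S, spin σ i := by
    simpa only [hπ] using! totalSpin_comp_perm S σ π
  have field_eq : ∑ i, h (π i) * spin (σ ∘ π) i = ∑ i, h i * spin σ i :=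
    Equiv.sum_comp π fun i ↦ h i * spin σ i
  exact congrArg Real.exp (congrArg₂ (θ / (2 * #S) * · ^ 2 + ·) clique_eq field_eq)

theorem exists_perm_map_eq_map_eq {α : Type*} {A D S : Finset α} (hA : A ⊆ S)
    (hD : D ⊆ S) (hAD : #A = #D) :
    ∃ π : Equiv.Perm α, A.map π.toEmbedding = D ∧ S.map π.toEmbedding = S := by
  classical
  have card_subtype {T : Finset α} (hT : T ⊆ S) : Fintype.card {x : S // x.1 ∈ T} = #T := by
    rw [← Fintype.card_coe T]
    exact Fintype.card_congr ⟨fun x ↦ ⟨x.1.1, x.2⟩, fun x ↦ ⟨⟨x.1, hT x.2⟩, x.2⟩,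
      fun _ ↦ rfl, fun _ ↦ rfl⟩
  let e : {x : S // x.1 ∈ A} ≃ {x : S // x.1 ∈ D} :=
    Fintype.equivOfCardEq (by rw [card_subtype hA, card_subtype hD, hAD])
  let π : Equiv.Perm α := Equiv.Perm.ofSubtype e.extendSubtype
  have map_eq {T U : Finset α} (hTU : ∀ i ∈ T, π i ∈ U) (hcard : #T = #U) :
      T.map π.toEmbedding = U :=
    eq_of_subset_of_card_le (map_subset_iff_subset_preimage.2 fun i hi ↦ by
      simpa using hTU i hi) (by simp [hcard])
  refine ⟨π, map_eq (fun i hi ↦ ?_) hAD, map_eq (fun i hi ↦ ?_) rfl⟩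
  · simp only [π, Equiv.Perm.ofSubtype_apply_of_mem e.extendSubtype (hA hi)]
    exact e.extendSubtype_mem ⟨i, hA hi⟩ hi
  · simp only [π, Equiv.Perm.ofSubtype_apply_of_mem e.extendSubtype hi]
    exact (e.extendSubtype ⟨i, hi⟩).2

theorem plantedMean_totalSpin_subset [SigmaFinite μ] {A : Finset (Fin n)} (hA : A ⊆ S)
    (Φ : ℝ → ℝ → ℝ) :
    plantedMean θ μ S (fun σ ↦ Φ (totalSpin S σ) (totalSpin A σ)) =
      plantedMean θ μ S fun σ ↦ 𝔼 D ∈ S.powersetCard #A, Φ (totalSpin S σ) (totalSpin D σ) := by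
  have perm_eq : ∀ D ∈ S.powersetCard #A,
      plantedMean θ μ S (fun σ ↦ Φ (totalSpin S σ) (totalSpin D σ)) =
        plantedMean θ μ S fun σ ↦ Φ (totalSpin S σ) (totalSpin A σ) := fun D hD ↦ by
    obtain ⟨hDS, hcard⟩ := mem_powersetCard.1 hD
    obtain ⟨π, hπA, hπS⟩ := exists_perm_map_eq_map_eq hA hDS hcard.symm
    rw [← plantedMean_comp_perm hπS fun σ ↦ Φ (totalSpin S σ) (totalSpin A σ)]
    simp_rw [totalSpin_comp_perm, hπA, hπS]
  rw [← expect_plantedMean, expect_congr rfl perm_eq,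
    expect_const (powersetCard_nonempty.2 (card_le_card hA))]

theorem plantedMean_exp_sq_totalSpin_sub_le [SigmaFinite μ] (hμ : μ.map (fun x : ℝ ↦ -x) = μ)
    {S' : Finset (Fin n)} (hS : S.Nonempty) (hS' : #S' = #S) {s : ℝ} (hs : 0 ≤ s)
    (hs' : s ≤ 1 / 12) {η : ℝ} (hη : η = #(S' \ S) / #S) :
    plantedMean θ μ S (fun σ ↦ Real.exp (s / #S * (totalSpin S' σ ^ 2 - totalSpin S σ ^ 2))) ≤
      plantedMean θ μ S fun σ ↦ Real.exp (s * η * (-(2 - η) * (sqMagnetization S σ - 1) +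
        1 / #S + 18 * s + 12 * s * sqMagnetization S σ)) := by
  have hcard : #(S \ S') = #(S' \ S) := card_sdiff_comm hS'.symm
  have totalSpin_S' (σ ε : SpinConfig n) : totalSpin S' (S.piecewise σ ε) =
      totalSpin S σ - totalSpin (S \ S') σ + totalSpin (S' \ S) ε := by
    have inside (A : Finset (Fin n)) (hA : A ⊆ S) : totalSpin A (S.piecewise σ ε) = totalSpin A σ :=
      sum_congr rfl fun i hi ↦ by simp [spin, hA hi]
    have outside : totalSpin (S' \ S) (S.piecewise σ ε) = totalSpin (S' \ S) ε :=
      sum_congr rfl fun i hi ↦ by simp [spin, (mem_sdiff.1 hi).2]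
    rw [← inside S Subset.rfl, ← inside (S \ S') sdiff_subset, ← outside]
    simp only [totalSpin]
    rw [← sum_inter_add_sum_sdiff S S', ← sum_inter_add_sum_sdiff S' S, inter_comm S' S]
    ring
  have totalSpin_S (σ ε : SpinConfig n) : totalSpin S (S.piecewise σ ε) = totalSpin S σ :=
    sum_congr rfl fun i hi ↦ by simp [spin, hi]
  rw [plantedMean_eq_plantedMean_expect_piecewise hμ]
  simp_rw [totalSpin_S', totalSpin_S]
  rw [plantedMean_totalSpin_subset sdiff_subset fun M D ↦ 𝔼 ε,
    Real.exp (s / #S * ((M - D + totalSpin (S' \ S) ε) ^ 2 - M ^ 2)), hcard]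
  refine plantedMean_mono fun σ ↦ ?_
  rw [expect_comm]
  exact expect_exchange_exp_le σ hS (hS' ▸ card_le_card sdiff_subset) hs hs' hη

end PlantedMean

section Tilting

theorem min_sub_min_le_min_sub_min {x y L₀ L : ℝ} (hL : L₀ ≤ L) (hyx : y ≤ x) :
    min x L₀ - min y L₀ ≤ min x L - min y L := by
  grind

theorem mul_sq_min_sub_min_le {x y t L₀ L : ℝ} (hx : 0 ≤ x) (hy : 0 ≤ y) (ht : 0 ≤ t)
    (hL₀ : 0 ≤ L₀) (hL : L₀ ≤ L) :
    t * (min x L₀ - min y L₀) ^ 2 ≤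
      (min x L - min y L) * (Real.exp (t * min x L₀) - Real.exp (t * min y L₀)) := by
  wlog hyx : y ≤ x generalizing x y
  · have := this hy hx (le_of_not_ge hyx)
    linarith
  have hd : 0 ≤ min x L₀ - min y L₀ := sub_nonneg.2 (min_le_min_right _ hyx)
  have exp_sub_ge : t * (min x L₀ - min y L₀) ≤
      Real.exp (t * min x L₀) - Real.exp (t * min y L₀) := by
    have hone : 1 ≤ Real.exp (t * min y L₀) := Real.one_le_exp (mul_nonneg ht (le_min hy hL₀))
    have hexp := Real.add_one_le_exp (t * (min x L₀ - min y L₀))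
    rw [show t * min x L₀ = t * min y L₀ + t * (min x L₀ - min y L₀) by ring, Real.exp_add]
    nlinarith [mul_nonneg ht hd]
  calc _ = (min x L₀ - min y L₀) * (t * (min x L₀ - min y L₀)) := by ring
    _ ≤ _ := mul_le_mul (min_sub_min_le_min_sub_min hL hyx) exp_sub_ge (mul_nonneg ht hd)
      (hd.trans (min_sub_min_le_min_sub_min hL hyx))

variable {Ω : Type*} {A : Finset Ω} {w : Ω → ℝ}

theorem expect_mul_mul_expect_sub_expect_mul_expect (A : Finset Ω) (w a b : Ω → ℝ) :
    (𝔼 i ∈ A, w i * (a i * b i)) * (𝔼 i ∈ A, w i) -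
        (𝔼 i ∈ A, w i * a i) * (𝔼 i ∈ A, w i * b i) =
      1 / 2 * 𝔼 i ∈ A, 𝔼 j ∈ A, w i * w j * ((a i - a j) * (b i - b j)) := by
  have expand (i j : Ω) : w i * w j * ((a i - a j) * (b i - b j)) =
      w i * (a i * b i) * w j - w i * a i * (w j * b j) -
        (w i * b i * (w j * a j) - w i * (w j * (a j * b j))) := by
    ring
  simp_rw [expand, expect_sub_distrib, ← expect_mul_expect]
  ring

theorem expect_mul_div_expect_le_of_monovary {a R : Ω → ℝ} (hw : ∀ i, 0 ≤ w i)
    (haR : Monovary a R) (hpos : 0 < 𝔼 i ∈ A, w i) (hposR : 0 < 𝔼 i ∈ A, w i * R i) :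
    (𝔼 i ∈ A, w i * a i) / (𝔼 i ∈ A, w i) ≤
      (𝔼 i ∈ A, w i * (a i * R i)) / 𝔼 i ∈ A, w i * R i := by
  rw [div_le_div_iff₀ hpos hposR, ← sub_nonneg, expect_mul_mul_expect_sub_expect_mul_expect]
  refine mul_nonneg (by norm_num) (expect_nonneg fun i _ ↦ expect_nonneg fun j _ ↦ ?_)
  exact mul_nonneg (mul_nonneg (hw i) (hw j)) (monovary_iff_forall_mul_nonneg.1 haR j i)

variable {X : Ω → ℝ} {t L₀ L : ℝ}

theorem one_le_expect_mul_exp (hw : ∀ i, 0 ≤ w i) (hw1 : 𝔼 i ∈ A, w i = 1) (hX : ∀ i, 0 ≤ X i)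
    (ht : 0 ≤ t) : 1 ≤ 𝔼 i ∈ A, w i * Real.exp (t * X i) :=
  hw1 ▸ expect_le_expect fun i _ ↦
    le_mul_of_one_le_right (hw i) (Real.one_le_exp (mul_nonneg ht (hX i)))

theorem expect_mul_min_add_variance_le_exp_min_tilt (hw : ∀ i, 0 ≤ w i) (hw1 : 𝔼 i ∈ A, w i = 1)
    (hX : ∀ i, 0 ≤ X i) (ht : 0 ≤ t) (hL₀ : 0 ≤ L₀) (hL : L₀ ≤ L) :
    𝔼 i ∈ A, w i * min (X i) L + t / 2 * Real.exp (-(t * L₀)) *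
        𝔼 i ∈ A, 𝔼 j ∈ A, w i * w j * (min (X i) L₀ - min (X j) L₀) ^ 2 ≤
      (𝔼 i ∈ A, w i * Real.exp (t * min (X i) L₀) * min (X i) L) /
        𝔼 i ∈ A, w i * Real.exp (t * min (X i) L₀) := by
  set T : Ω → ℝ := fun i ↦ Real.exp (t * min (X i) L₀)
  set V := 𝔼 i ∈ A, 𝔼 j ∈ A, w i * w j * (min (X i) L₀ - min (X j) L₀) ^ 2
  have hV : 0 ≤ V := expect_nonneg fun i _ ↦ expect_nonneg fun j _ ↦
    mul_nonneg (mul_nonneg (hw i) (hw j)) (sq_nonneg _)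
  have covariance_ge : t * V ≤
      𝔼 i ∈ A, 𝔼 j ∈ A, w i * w j * ((min (X i) L - min (X j) L) * (T i - T j)) := by
    simp_rw [V, mul_expect, mul_left_comm t]
    exact expect_le_expect fun i _ ↦ expect_le_expect fun j _ ↦ mul_le_mul_of_nonneg_left
      (mul_sq_min_sub_min_le (hX i) (hX j) ht hL₀ hL) (mul_nonneg (hw i) (hw j))
  have covariance_eq := expect_mul_mul_expect_sub_expect_mul_expect A w (fun i ↦ min (X i) L) T
  have normalizer_pos : 0 < 𝔼 i ∈ A, w i * T i := zero_lt_one.trans_le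
    (one_le_expect_mul_exp hw hw1 (fun i ↦ le_min (hX i) hL₀) ht)
  have normalizer_le : 𝔼 i ∈ A, w i * T i ≤ Real.exp (t * L₀) := calc
    _ ≤ 𝔼 i ∈ A, w i * Real.exp (t * L₀) := expect_le_expect fun i _ ↦
      mul_le_mul_of_nonneg_left (Real.exp_le_exp.2 (by gcongr; exact min_le_right _ _)) (hw i)
    _ = _ := by rw [← expect_mul, hw1, one_mul]
  have variance_term_le : t / 2 * Real.exp (-(t * L₀)) * V * 𝔼 i ∈ A, w i * T i ≤ t / 2 * V := calc
    _ ≤ t / 2 * Real.exp (-(t * L₀)) * V * Real.exp (t * L₀) := by gcongr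
    _ = t / 2 * V * (Real.exp (-(t * L₀)) * Real.exp (t * L₀)) := by ring
    _ = _ := by rw [← Real.exp_add, neg_add_cancel, Real.exp_zero, mul_one]
  rw [le_div_iff₀ normalizer_pos, add_mul]
  have tilted_eq : 𝔼 i ∈ A, w i * Real.exp (t * min (X i) L₀) * min (X i) L =
      𝔼 i ∈ A, w i * (min (X i) L * T i) := expect_congr rfl fun i _ ↦ by ring
  rw [hw1, mul_one] at covariance_eq
  linarith

theorem monovary_min_exp_sub_min (X : Ω → ℝ) (ht : 0 ≤ t) (L₀ L : ℝ) :
    Monovary (fun i ↦ min (X i) L) fun i ↦ Real.exp (t * (X i - min (X i) L₀)) := by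
  have min_mono : Monotone fun x : ℝ ↦ min x L := fun x y hxy ↦ min_le_min_right L hxy
  have excess_mono : Monotone fun x : ℝ ↦ Real.exp (t * (x - min x L₀)) := fun x y hxy ↦ by
    have : x - min x L₀ ≤ y - min y L₀ := by grind
    simp only
    gcongr
  exact (min_mono.monovary excess_mono).comp_right X

theorem expect_mul_min_add_variance_le_exp_tilt (hw : ∀ i, 0 ≤ w i) (hw1 : 𝔼 i ∈ A, w i = 1)
    (hX : ∀ i, 0 ≤ X i) (ht : 0 ≤ t) (hL₀ : 0 ≤ L₀) (hL : L₀ ≤ L) :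
    𝔼 i ∈ A, w i * min (X i) L + t / 2 * Real.exp (-(t * L₀)) *
        𝔼 i ∈ A, 𝔼 j ∈ A, w i * w j * (min (X i) L₀ - min (X j) L₀) ^ 2 ≤
      (𝔼 i ∈ A, w i * (Real.exp (t * X i) * min (X i) L)) /
        𝔼 i ∈ A, w i * Real.exp (t * X i) := by
  have exp_split (i : Ω) : Real.exp (t * X i) =
      Real.exp (t * min (X i) L₀) * Real.exp (t * (X i - min (X i) L₀)) := by
    rw [← Real.exp_add]
    ring_nf
  have normalizer_pos := zero_lt_one.trans_le (one_le_expect_mul_exp hw hw1 hX ht)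
  have min_normalizer_pos := zero_lt_one.trans_le
    (one_le_expect_mul_exp hw hw1 (fun i ↦ le_min (hX i) hL₀) ht)
  refine (expect_mul_min_add_variance_le_exp_min_tilt hw hw1 hX ht hL₀ hL).trans ?_
  simp_rw [exp_split, ← mul_assoc] at normalizer_pos ⊢
  simpa only [mul_assoc, mul_comm (min _ _)] using expect_mul_div_expect_le_of_monovary
    (fun i ↦ mul_nonneg (hw i) (Real.exp_nonneg _)) (monovary_min_exp_sub_min X ht L₀ L)
    min_normalizer_pos normalizer_pos

end Tilting

section RandomField

variable {n : ℕ} {μ : Measure ℝ}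

theorem signDensity_nonneg {a : Fin n → ℝ} (ha : ∀ i, |a i| ≤ 1) (σ : SpinConfig n) :
    0 ≤ signDensity a σ :=
  prod_nonneg fun i _ ↦ by
    have := abs_le.1 (ha i)
    rcases spin_eq_one_or_neg_one σ i with h | h <;> rw [h] <;> linarith

theorem gibbsWeight_eq_prod_cosh_mul (θ : ℝ) (S : Finset (Fin n)) (h : Fin n → ℝ)
    (σ : SpinConfig n) :
    gibbsWeight θ S h σ = (∏ i, Real.cosh (h i)) *
      (signDensity (Real.tanh ∘ h) σ * Real.exp (θ / 2 * sqMagnetization S σ)) := by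
  have exp_field (i : Fin n) : Real.exp (h i * spin σ i) =
      Real.cosh (h i) * (1 + Real.tanh (h i) * spin σ i) := by
    have hcosh := (Real.cosh_pos (h i)).ne'
    rw [Real.tanh_eq_sinh_div_cosh]
    rcases spin_eq_one_or_neg_one σ i with hσ | hσ <;> rw [hσ] <;> field_simp
    · rw [Real.cosh_add_sinh]
    · rw [← Real.cosh_sub_sinh, sub_eq_add_neg]
  have clique_eq : θ / (2 * #S) * (∑ i ∈ S, spin σ i) ^ 2 = θ / 2 * sqMagnetization S σ := by
    rw [sqMagnetization, totalSpin]
    ring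
  rw [gibbsWeight, clique_eq, Real.exp_add, Real.exp_sum, signDensity, ← mul_assoc,
    ← prod_mul_distrib, mul_comm]
  simp_rw [exp_field, Function.comp_apply]

theorem sum_gibbsProb_mul (θ : ℝ) (S : Finset (Fin n)) (h : Fin n → ℝ) (F : SpinConfig n → ℝ) :
    ∑ σ, gibbsProb θ S h σ * F σ =
      (𝔼 σ, signDensity (Real.tanh ∘ h) σ * (Real.exp (θ / 2 * sqMagnetization S σ) * F σ)) /
        𝔼 σ, signDensity (Real.tanh ∘ h) σ * Real.exp (θ / 2 * sqMagnetization S σ) := by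
  have hcosh : ∏ i, Real.cosh (h i) ≠ 0 := prod_ne_zero_iff.2 fun i _ ↦ (Real.cosh_pos _).ne'
  simp_rw [gibbsProb, gibbsWeight_eq_prod_cosh_mul, ← mul_sum, mul_div_mul_left _ _ hcosh,
    div_mul_eq_mul_div, ← sum_div, mul_assoc, Fintype.expect_eq_sum_div_card]
  rw [div_div_div_cancel_right₀ (by simp)]

theorem continuous_tanh : Continuous Real.tanh := by
  rw [show Real.tanh = fun x ↦ Real.sinh x / Real.cosh x from funext Real.tanh_eq_sinh_div_cosh]
  exact Real.continuous_sinh.div Real.continuous_cosh fun x ↦ (Real.cosh_pos x).ne'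

theorem integrable_comp_tanh [IsFiniteMeasure μ] {f : ℝ → ℝ} (hf : Continuous f) :
    Integrable (fun x ↦ f (Real.tanh x)) μ := by
  obtain ⟨C, hC⟩ := (isCompact_Icc (a := (-1 : ℝ)) (b := 1)).exists_bound_of_continuousOn
    hf.continuousOn
  exact .of_bound (hf.comp continuous_tanh).aestronglyMeasurable C <| .of_forall fun x ↦
    hC _ ⟨(Real.neg_one_lt_tanh x).le, (Real.tanh_lt_one x).le⟩

theorem integral_tanh_eq_zero (hμ : μ.map (fun x : ℝ ↦ -x) = μ) : ∫ x, Real.tanh x ∂μ = 0 := by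
  have h : ∫ x, Real.tanh x ∂μ = ∫ x, Real.tanh (-x) ∂μ := by
    conv_lhs => rw [← hμ]
    exact integral_map measurable_neg.aemeasurable continuous_tanh.aestronglyMeasurable
  simp only [Real.tanh_neg, integral_neg] at h
  linarith

variable [IsProbabilityMeasure μ]

variable (μ) in
theorem integral_tanh_sq_lt_one : ∫ x, Real.tanh x ^ 2 ∂μ < 1 := by
  have hint : Integrable (fun x ↦ Real.tanh x ^ 2) μ :=
    integrable_comp_tanh (continuous_pow 2)
  have h : 0 < ∫ x, (1 - Real.tanh x ^ 2) ∂μ := by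
    rw [integral_pos_iff_support_of_nonneg
      (fun x ↦ sub_nonneg.2 (Real.tanh_sq_lt_one x).le) ((integrable_const 1).sub hint),
      Function.support_eq_univ fun x ↦ (sub_pos.2 (Real.tanh_sq_lt_one x)).ne']
    simp
  rw [integral_sub (integrable_const 1) hint] at h
  simpa using h

theorem integrable_signDensity_tanh (σ : SpinConfig n) :
    Integrable (fun h : Fin n → ℝ ↦ signDensity (Real.tanh ∘ h) σ) (Measure.pi fun _ ↦ μ) :=
  .fintype_prod fun i ↦ integrable_comp_tanh (f := fun x ↦ 1 + x * spin σ i) (by fun_prop)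

theorem integrable_signDensity_tanh_mul (σ ρ : SpinConfig n) :
    Integrable (fun h : Fin n → ℝ ↦ signDensity (Real.tanh ∘ h) σ * signDensity (Real.tanh ∘ h) ρ)
      (Measure.pi fun _ ↦ μ) := by
  simp_rw [signDensity, ← prod_mul_distrib]
  exact .fintype_prod fun i ↦
    integrable_comp_tanh (f := fun x ↦ (1 + x * spin σ i) * (1 + x * spin ρ i)) (by fun_prop)

theorem integral_signDensity_tanh (hμ : μ.map (fun x : ℝ ↦ -x) = μ) (σ : SpinConfig n) :
    ∫ h, signDensity (Real.tanh ∘ h) σ ∂(Measure.pi fun _ : Fin n ↦ μ) = 1 := by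
  have htanh : Integrable Real.tanh μ := integrable_comp_tanh continuous_id
  refine (integral_fintype_prod_eq_prod fun i x ↦ 1 + Real.tanh x * spin σ i).trans
    (prod_eq_one fun i _ ↦ ?_)
  rw [integral_add (integrable_const _) (htanh.mul_const _), integral_mul_const,
    integral_tanh_eq_zero hμ]
  simp

theorem integral_signDensity_tanh_mul (hμ : μ.map (fun x : ℝ ↦ -x) = μ) (σ ρ : SpinConfig n) :
    ∫ h, signDensity (Real.tanh ∘ h) σ * signDensity (Real.tanh ∘ h) ρ
        ∂(Measure.pi fun _ : Fin n ↦ μ) =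
      signDensity (fun _ ↦ ∫ x, Real.tanh x ^ 2 ∂μ) (σ * ρ) := by
  have htanh : Integrable Real.tanh μ := integrable_comp_tanh continuous_id
  have htanh_sq : Integrable (fun x ↦ Real.tanh x ^ 2) μ :=
    integrable_comp_tanh (continuous_pow 2)
  have expand (i : Fin n) (x : ℝ) :
      (1 + Real.tanh x * spin σ i) * (1 + Real.tanh x * spin ρ i) =
        1 + (Real.tanh x * (spin σ i + spin ρ i) + Real.tanh x ^ 2 * (spin σ i * spin ρ i)) := by
    ring
  simp_rw [signDensity, ← prod_mul_distrib]
  refine (integral_fintype_prod_eq_prod fun i x ↦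
    (1 + Real.tanh x * spin σ i) * (1 + Real.tanh x * spin ρ i)).trans (prod_congr rfl fun i _ ↦ ?_)
  simp_rw [expand]
  rw [integral_add (integrable_const _) ((htanh.mul_const _).fun_add (htanh_sq.mul_const _)),
    integral_add (htanh.mul_const _) (htanh_sq.mul_const _), integral_mul_const,
    integral_mul_const, integral_tanh_eq_zero hμ, spin_mul]
  simp

end RandomField

section MagnetizationGain

theorem half_sq_sub_sub_cubes_le_sq_min_sub_min {x y L : ℝ} (hx : 0 ≤ x) (hy : 0 ≤ y) (hL : 0 < L) :
    1 / 2 * (x - y) ^ 2 - 2 / L * x ^ 3 - 2 / L * y ^ 3 ≤ (min x L - min y L) ^ 2 := by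
  have sq_excess_le {x : ℝ} (hx : 0 ≤ x) : (x - min x L) ^ 2 ≤ x ^ 3 / L := by
    rw [le_div_iff₀ hL]
    rcases le_total x L with h | h
    · simpa [min_eq_left h] using pow_nonneg hx 3
    · rw [min_eq_right h]
      calc (x - L) ^ 2 * L ≤ x ^ 2 * x := by gcongr; linarith
        _ = x ^ 3 := by ring
  have hx' := sq_excess_le hx
  have hy' := sq_excess_le hy
  have rewrite_cubes : 2 / L * x ^ 3 + 2 / L * y ^ 3 = 2 * (x ^ 3 / L) + 2 * (y ^ 3 / L) := by ring
  nlinarith [sq_nonneg ((min x L - min y L) - ((x - min x L) - (y - min y L))),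
    sq_nonneg ((x - min x L) + (y - min y L))]

theorem sub_sq_div_le_min {x L : ℝ} (hL : 0 < L) : x - x ^ 2 / L ≤ min x L := by
  refine le_min (sub_le_self _ (by positivity)) ?_
  rw [sub_le_iff_le_add, ← sub_le_iff_le_add', le_div_iff₀ hL]
  nlinarith [sq_nonneg (x - L)]

variable {n : ℕ} {S : Finset (Fin n)} {L : ℝ}

theorem le_expect_min_sqMagnetization (hS : S.Nonempty) (hL : 0 < L) :
    1 - 3 / L ≤ 𝔼 σ, min (sqMagnetization S σ) L := calc
  1 - 3 / L ≤ 1 - (3 - 2 / #S) / L := by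
    gcongr
    exact sub_le_self _ (by positivity)
  _ = 𝔼 σ, (sqMagnetization S σ - sqMagnetization S σ ^ 2 / L) := by
    rw [expect_sub_distrib, ← expect_div, expect_sqMagnetization hS, expect_sq_sqMagnetization hS]
  _ ≤ _ := expect_le_expect fun σ _ ↦ sub_sq_div_le_min hL

theorem le_expect_sq_min_sub_min (hS : S.Nonempty) (hL : 0 < L) (e : SpinConfig n) :
    2 * (1 - (totalSpin S e / #S) ^ 2) - 11520 / L ≤
      𝔼 σ, (min (sqMagnetization S σ) L - min (sqMagnetization S (e * σ)) L) ^ 2 := by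
  have expect_mul_left (F : SpinConfig n → ℝ) : 𝔼 σ, F (e * σ) = 𝔼 σ, F σ :=
    Fintype.expect_equiv (Equiv.mulLeft e) _ _ fun _ ↦ rfl
  have expand (σ : SpinConfig n) : 1 / 2 * (sqMagnetization S σ - sqMagnetization S (e * σ)) ^ 2 =
      1 / 2 * sqMagnetization S σ ^ 2 + 1 / 2 * sqMagnetization S (e * σ) ^ 2 -
        sqMagnetization S σ * sqMagnetization S (e * σ) := by
    ring
  calc _ ≤ 2 * (1 - (totalSpin S e / #S) ^ 2) -
        2 / L * (𝔼 σ, sqMagnetization S σ ^ 3) - 2 / L * 𝔼 σ, sqMagnetization S σ ^ 3 := by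
        have := mul_le_mul_of_nonneg_left (expect_sqMagnetization_pow_three_le hS)
          (show 0 ≤ 2 / L by positivity)
        linear_combination 2 * this
    _ = 𝔼 σ, (1 / 2 * (sqMagnetization S σ - sqMagnetization S (e * σ)) ^ 2 -
        2 / L * sqMagnetization S σ ^ 3 - 2 / L * sqMagnetization S (e * σ) ^ 3) := by
        simp_rw [expand, expect_sub_distrib, expect_add_distrib, ← mul_expect,
          expect_mul_left (sqMagnetization S · ^ 2), expect_mul_left (sqMagnetization S · ^ 3),
          expect_sq_sqMagnetization hS, expect_sqMagnetization_mul_sqMagnetization_mul hS]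
        ring
    _ ≤ _ := expect_le_expect fun σ _ ↦ half_sq_sub_sub_cubes_le_sq_min_sub_min
      (sqMagnetization_nonneg S _) (sqMagnetization_nonneg S _) hL

theorem expect_expect_signDensity_mul (a : Fin n → ℝ) (G : SpinConfig n → SpinConfig n → ℝ) :
    𝔼 σ, 𝔼 ρ, signDensity a (σ * ρ) * G σ ρ = 𝔼 e, signDensity a e * 𝔼 σ, G σ (e * σ) := by
  have mul_cancel (σ e : SpinConfig n) : σ * (e * σ) = e := funext fun i ↦ by
    rw [Pi.mul_apply, Pi.mul_apply, mul_left_comm, Int.units_mul_self, mul_one]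
  calc _ = 𝔼 σ, 𝔼 e, signDensity a e * G σ (e * σ) := expect_congr rfl fun σ _ ↦
        (Fintype.expect_equiv (Equiv.mulRight σ) _ _ fun e ↦ by simp [mul_cancel]).symm
    _ = _ := by
        rw [expect_comm]
        simp_rw [mul_expect]

theorem le_expect_expect_signDensity_mul_sq_min_sub_min (hS : S.Nonempty) (hL : 0 < L) {τ : ℝ}
    (hτ : |τ| ≤ 1) :
    2 * (1 - 1 / #S) * (1 - τ ^ 2) - 11520 / L ≤ 𝔼 σ, 𝔼 ρ, signDensity (fun _ ↦ τ) (σ * ρ) *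
      (min (sqMagnetization S σ) L - min (sqMagnetization S ρ) L) ^ 2 := by
  have hcard : (#S : ℝ) ≠ 0 := by simp [hS.ne_empty]
  have expand (e : SpinConfig n) :
      signDensity (fun _ ↦ τ) e * (2 * (1 - (totalSpin S e / #S) ^ 2) - 11520 / L) =
        (2 - 11520 / L) * signDensity (fun _ ↦ τ) e -
          2 / #S ^ 2 * (signDensity (fun _ ↦ τ) e * totalSpin S e ^ 2) := by
    ring
  rw [expect_expect_signDensity_mul]
  calc _ = 𝔼 e, signDensity (fun _ ↦ τ) e *
        (2 * (1 - (totalSpin S e / #S) ^ 2) - 11520 / L) := by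
        simp_rw [expand, expect_sub_distrib, ← mul_expect, expect_signDensity,
          expect_signDensity_mul_sq_totalSpin, sum_const, nsmul_eq_mul]
        field_simp
        ring
    _ ≤ _ := expect_le_expect fun e _ ↦ mul_le_mul_of_nonneg_left
      (le_expect_sq_min_sub_min hS hL e) (signDensity_nonneg (fun _ ↦ hτ) e)

theorem integrable_expect {Ω ι : Type*} [MeasurableSpace Ω] {ν : Measure Ω} {A : Finset ι}
    {f : ι → Ω → ℝ} (hf : ∀ i ∈ A, Integrable (f i) ν) : Integrable (fun x ↦ 𝔼 i ∈ A, f i x) ν := by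
  simp_rw [expect_eq_sum_div_card]
  exact (integrable_finsetSum A hf).div_const _

theorem integral_expect {Ω ι : Type*} [MeasurableSpace Ω] {ν : Measure Ω} {A : Finset ι}
    {f : ι → Ω → ℝ} (hf : ∀ i ∈ A, Integrable (f i) ν) :
    ∫ x, 𝔼 i ∈ A, f i x ∂ν = 𝔼 i ∈ A, ∫ x, f i x ∂ν := by
  simp_rw [expect_eq_sum_div_card, integral_div, integral_finsetSum A hf]

variable {θ L₀ : ℝ} {μ : Measure ℝ}

theorem le_sum_gibbsProb_mul_min_sqMagnetization (hθ : 0 ≤ θ) (hL₀ : 0 ≤ L₀) (hL : L₀ ≤ L)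
    (h : Fin n → ℝ) :
    𝔼 σ, signDensity (Real.tanh ∘ h) σ * min (sqMagnetization S σ) L +
        θ / 4 * Real.exp (-(θ / 2 * L₀)) *
          𝔼 σ, 𝔼 ρ, signDensity (Real.tanh ∘ h) σ * signDensity (Real.tanh ∘ h) ρ *
            (min (sqMagnetization S σ) L₀ - min (sqMagnetization S ρ) L₀) ^ 2 ≤
      ∑ σ, gibbsProb θ S h σ * min (sqMagnetization S σ) L := by
  rw [sum_gibbsProb_mul, show θ / 4 = θ / 2 / 2 by ring]
  exact expect_mul_min_add_variance_le_exp_tilt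
    (signDensity_nonneg fun i ↦ (Real.abs_tanh_lt_one _).le) (expect_signDensity _)
    (sqMagnetization_nonneg S) (by positivity) hL₀ hL

theorem le_plantedMean_min_sqMagnetization [IsProbabilityMeasure μ]
    (hμ : μ.map (fun x : ℝ ↦ -x) = μ) (hS : S.Nonempty) (hθ : 0 ≤ θ) (hL₀ : 0 < L₀) (hL : L₀ ≤ L) :
    1 - 3 / L + θ / 4 * Real.exp (-(θ / 2 * L₀)) *
        (2 * (1 - 1 / #S) * (1 - (∫ x, Real.tanh x ^ 2 ∂μ) ^ 2) - 11520 / L₀) ≤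
      plantedMean θ μ S fun σ ↦ min (sqMagnetization S σ) L := by
  set τ := ∫ x, Real.tanh x ^ 2 ∂μ
  have hτ : |τ| ≤ 1 := by
    rw [abs_of_nonneg (integral_nonneg fun _ ↦ sq_nonneg _)]
    exact (integral_tanh_sq_lt_one μ).le
  have integrable_one (σ : SpinConfig n) := (integrable_signDensity_tanh (μ := μ) σ).mul_const
    (min (sqMagnetization S σ) L)
  have integrable_two (σ ρ : SpinConfig n) :=
    (integrable_signDensity_tanh_mul (μ := μ) σ ρ).mul_const
      ((min (sqMagnetization S σ) L₀ - min (sqMagnetization S ρ) L₀) ^ 2)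
  have integrable_mean := integrable_expect (A := univ) fun σ _ ↦ integrable_one σ
  have integrable_variance := (integrable_expect (A := univ) fun σ _ ↦
    integrable_expect (A := univ) fun ρ _ ↦ integrable_two σ ρ).const_mul
      (θ / 4 * Real.exp (-(θ / 2 * L₀)))
  calc _ ≤ 𝔼 σ, min (sqMagnetization S σ) L + θ / 4 * Real.exp (-(θ / 2 * L₀)) *
        𝔼 σ, 𝔼 ρ, signDensity (fun _ ↦ τ) (σ * ρ) *
          (min (sqMagnetization S σ) L₀ - min (sqMagnetization S ρ) L₀) ^ 2 := by
        gcongr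
        · exact le_expect_min_sqMagnetization hS (hL₀.trans_le hL)
        · exact le_expect_expect_signDensity_mul_sq_min_sub_min hS hL₀ hτ
    _ = ∫ h, (𝔼 σ, signDensity (Real.tanh ∘ h) σ * min (sqMagnetization S σ) L +
        θ / 4 * Real.exp (-(θ / 2 * L₀)) *
          𝔼 σ, 𝔼 ρ, signDensity (Real.tanh ∘ h) σ * signDensity (Real.tanh ∘ h) ρ *
            (min (sqMagnetization S σ) L₀ - min (sqMagnetization S ρ) L₀) ^ 2)
          ∂(Measure.pi fun _ : Fin n ↦ μ) := by
        rw [integral_add integrable_mean integrable_variance, integral_const_mul,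
          integral_expect fun σ _ ↦ integrable_one σ,
          integral_expect fun σ _ ↦ integrable_expect fun ρ _ ↦ integrable_two σ ρ]
        simp_rw [integral_expect fun ρ _ ↦ integrable_two _ ρ, integral_mul_const,
          integral_signDensity_tanh hμ, integral_signDensity_tanh_mul hμ, one_mul]
        rfl
    _ ≤ _ := by
        rw [plantedMean_eq_integral]
        exact integral_mono (integrable_mean.add integrable_variance)
          (integrable_finsetSum _ fun σ _ ↦ (integrable_gibbsProb σ).mul_const _)
          (le_sum_gibbsProb_mul_min_sqMagnetization hθ hL₀.le hL)

theorem exists_one_add_le_plantedMean_min_sqMagnetization [IsProbabilityMeasure μ]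
    (hμ : μ.map (fun x : ℝ ↦ -x) = μ) (hθ : 0 < θ) :
    ∃ c L : ℝ, 0 < c ∧ 1 ≤ L ∧ ∀ (n : ℕ) (S : Finset (Fin n)), 2 ≤ #S →
      1 + c ≤ plantedMean θ μ S fun σ ↦ min (sqMagnetization S σ) L := by
  set τ := ∫ x, Real.tanh x ^ 2 ∂μ
  obtain ⟨v, hv⟩ : ∃ v, v = 1 - τ ^ 2 := ⟨_, rfl⟩
  have v_pos : 0 < v := by
    have : τ < 1 := integral_tanh_sq_lt_one μ
    have : 0 ≤ τ := integral_nonneg fun _ ↦ sq_nonneg _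
    nlinarith
  set L₀ := 23040 / v
  set κ := θ / 4 * Real.exp (-(θ / 2 * L₀))
  set L := max (max L₀ 1) (12 / (κ * v))
  have L₀_pos : 0 < L₀ := by positivity
  have κ_pos : 0 < κ := by positivity
  have one_le_L : 1 ≤ L := (le_max_right _ _).trans (le_max_left _ _)
  have three_div_L_le : 3 / L ≤ κ * v / 4 := by
    have := (div_le_iff₀ (by positivity)).1 (le_max_right (max L₀ 1) (12 / (κ * v)))
    rw [div_le_iff₀ (by positivity)]
    linarith
  refine ⟨κ * v / 4, L, by positivity, one_le_L, fun n S hS ↦ ?_⟩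
  have variance_ge : v / 2 ≤ 2 * (1 - 1 / #S) * v - 11520 / L₀ := by
    have : 1 / (#S : ℝ) ≤ 1 / 2 := one_div_le_one_div_of_le two_pos (by exact_mod_cast hS)
    have : 11520 / L₀ = v / 2 := by
      simp only [L₀]
      field_simp
      norm_num
    nlinarith
  calc _ ≤ 1 - 3 / L + κ * (2 * (1 - 1 / #S) * v - 11520 / L₀) := by
        linarith [mul_le_mul_of_nonneg_left variance_ge κ_pos.le]
    _ ≤ _ := hv ▸ le_plantedMean_min_sqMagnetization hμ (card_pos.1 (two_pos.trans_le hS)) hθ.le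
      L₀_pos ((le_max_left _ _).trans (le_max_left _ _))

end MagnetizationGain

section OneObservation

theorem exp_exchange_exponent_le {s η r x L : ℝ} (hs : 0 ≤ s) (hs12 : s ≤ 1 / 12)
    (hsL : s * (3 * L + 5) ≤ 1) (hη : 0 ≤ η) (hη1 : η ≤ 1) (hr : 0 ≤ r) (hr1 : r ≤ 1) (hx : 0 ≤ x)
    (hL : 0 ≤ L) :
    Real.exp (s * η * (-(2 - η) * (x - 1) + r + 18 * s + 12 * s * x)) ≤
      1 + s * η * (2 - η + r + s * (18 + 12 * L + (3 * L + 5) ^ 2)) -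
        s * η * (2 - η) * min x L := by
  set y := min x L
  set b := -(2 - η) * (y - 1) + r + 18 * s + 12 * s * y
  have hsη : 0 ≤ s * η := mul_nonneg hs hη
  have y_nonneg : 0 ≤ y := le_min hx hL
  have y_le : y ≤ L := min_le_right _ _
  have sy_nonneg : 0 ≤ s * y := mul_nonneg hs y_nonneg
  have sy_le : 12 * (s * y) ≤ 12 * (s * L) := by gcongr
  have sL_le : 12 * (s * L) ≤ L := by nlinarith
  have ηy_nonneg : 0 ≤ η * y := mul_nonneg hη y_nonneg
  have ηy_le : η * y ≤ y := mul_le_of_le_one_left y_nonneg hη1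
  have exponent_le : -(2 - η) * (x - 1) + r + 18 * s + 12 * s * x ≤ b := by
    nlinarith [mul_nonneg (sub_nonneg.2 (min_le_left x L)) (show 0 ≤ 2 - η - 12 * s by linarith)]
  have abs_b_le : |b| ≤ 3 * L + 5 := abs_le.2 ⟨by linarith, by linarith⟩
  have abs_le : |s * η * b| ≤ s * η * (3 * L + 5) := by
    rw [abs_mul, abs_of_nonneg hsη]
    gcongr
  have abs_le_one : |s * η * b| ≤ 1 := calc
    _ ≤ s * η * (3 * L + 5) := abs_le
    _ = η * (s * (3 * L + 5)) := by ring
    _ ≤ 1 := mul_le_one₀ hη1 (by positivity) hsL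
  have sq_le : (s * η * b) ^ 2 ≤ s * η * (s * (3 * L + 5) ^ 2) := calc
    _ = |s * η * b| ^ 2 := (sq_abs _).symm
    _ ≤ (s * η * (3 * L + 5)) ^ 2 := by gcongr
    _ = s * η * (s * (3 * L + 5) ^ 2) * η := by ring
    _ ≤ _ := mul_le_of_le_one_right (by positivity) hη1
  calc _ ≤ Real.exp (s * η * b) := Real.exp_le_exp.2 (mul_le_mul_of_nonneg_left exponent_le hsη)
    _ ≤ 1 + s * η * b + (s * η * b) ^ 2 := by
      linarith [(_root_.abs_le.1 (Real.abs_exp_sub_one_sub_id_le abs_le_one)).2]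
    _ ≤ _ := by nlinarith [mul_le_mul_of_nonneg_left sy_le hsη]

variable {n : ℕ} {θ : ℝ} {μ : Measure ℝ} [IsProbabilityMeasure μ]

theorem plantedMean_exp_sq_totalSpin_sub_le_of_gain (hμ : μ.map (fun x : ℝ ↦ -x) = μ)
    {S S' : Finset (Fin n)} (hS : S.Nonempty) (hS' : #S' = #S) {s c L : ℝ} (hs : 0 ≤ s)
    (hs12 : s ≤ 1 / 12) (hsL : s * (3 * L + 5) ≤ 1) (hL : 0 ≤ L) (hc : 0 ≤ c)
    (hsc : s * (18 + 12 * L + (3 * L + 5) ^ 2) ≤ c / 4) (hSc : 1 / #S ≤ c / 4)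
    (gain : 1 + c ≤ plantedMean θ μ S fun σ ↦ min (sqMagnetization S σ) L) :
    plantedMean θ μ S (fun σ ↦ Real.exp (s / #S * (totalSpin S' σ ^ 2 - totalSpin S σ ^ 2))) ≤
      Real.exp (-(s * c / 2 * (#(S' \ S) / #S))) := by
  have card_pos : (0 : ℝ) < #S := by simpa using hS.card_pos
  obtain ⟨η, hη⟩ : ∃ η : ℝ, η = #(S' \ S) / #S := ⟨_, rfl⟩
  have η_nonneg : 0 ≤ η := hη ▸ by positivity
  have η_le_one : η ≤ 1 := by
    rw [hη, div_le_one card_pos, ← hS']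
    exact_mod_cast card_le_card sdiff_subset
  have inv_card_le_one : 1 / (#S : ℝ) ≤ 1 := (div_le_one card_pos).2 (by exact_mod_cast hS.card_pos)
  set Q := 18 + 12 * L + (3 * L + 5) ^ 2
  set M := plantedMean θ μ S fun σ ↦ min (sqMagnetization S σ) L
  have sη_nonneg : 0 ≤ s * η := mul_nonneg hs η_nonneg
  rw [← hη]
  calc _ ≤ plantedMean θ μ S fun σ ↦ Real.exp (s * η * (-(2 - η) * (sqMagnetization S σ - 1) +
        1 / #S + 18 * s + 12 * s * sqMagnetization S σ)) :=
        plantedMean_exp_sq_totalSpin_sub_le hμ hS hS' hs hs12 hη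
    _ ≤ plantedMean θ μ S fun σ ↦ 1 + s * η * (2 - η + 1 / #S + s * Q) -
        s * η * (2 - η) * min (sqMagnetization S σ) L := plantedMean_mono fun σ ↦
        exp_exchange_exponent_le hs hs12 hsL η_nonneg η_le_one (by positivity) inv_card_le_one
          (sqMagnetization_nonneg S σ) hL
    _ = 1 + s * η * (2 - η + 1 / #S + s * Q) - s * η * (2 - η) * M :=
        plantedMean_const_sub_mul _ _ _
    _ ≤ 1 + s * η * (2 - η + c / 4 + c / 4) - s * η * (2 - η) * (1 + c) := by
        gcongr
        exact mul_nonneg sη_nonneg (by linarith)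
    _ ≤ -(s * c / 2 * η) + 1 := by
        nlinarith [mul_nonneg (mul_nonneg sη_nonneg hc) (sub_nonneg.2 η_le_one)]
    _ ≤ _ := Real.add_one_le_exp _

theorem exists_plantedMean_exp_sq_totalSpin_sub_le (hμ : μ.map (fun x : ℝ ↦ -x) = μ) (hθ : 0 < θ) :
    ∃ s c : ℝ, ∃ K : ℕ, 0 < s ∧ 0 < c ∧ ∀ (n : ℕ) (S S' : Finset (Fin n)), K ≤ #S → #S' = #S →
      plantedMean θ μ S (fun σ ↦ Real.exp (s / #S * (totalSpin S' σ ^ 2 - totalSpin S σ ^ 2))) ≤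
        Real.exp (-(c * (#(S' \ S) / #S))) := by
  obtain ⟨c, L, hc, hL, gain⟩ := exists_one_add_le_plantedMean_min_sqMagnetization hμ hθ
  set Q := 18 + 12 * L + (3 * L + 5) ^ 2
  set s := min (1 / 12) (min (1 / (3 * L + 5)) (c / (4 * Q)))
  have hs : 0 < s := by positivity
  have hsL : s * (3 * L + 5) ≤ 1 :=
    (le_div_iff₀ (by positivity)).1 ((min_le_right _ _).trans (min_le_left _ _))
  have hsQ : s * Q ≤ c / 4 := by
    have := (le_div_iff₀ (by positivity)).1
      ((min_le_right (1 / 12) (min (1 / (3 * L + 5)) (c / (4 * Q)))).trans (min_le_right _ _))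
    linarith
  refine ⟨s, s * c / 2, ⌈4 / c⌉₊ + 2, hs, by positivity, fun n S S' hK hS' ↦ ?_⟩
  have hS : S.Nonempty := card_pos.1 (by lia)
  have hSc : 1 / (#S : ℝ) ≤ c / 4 := by
    have : 4 / c ≤ #S := (Nat.le_ceil _).trans (by exact_mod_cast (by lia : ⌈4 / c⌉₊ ≤ #S))
    simpa using one_div_le_one_div_of_le (by positivity) this
  exact plantedMean_exp_sq_totalSpin_sub_le_of_gain hμ hS hS' hs.le (min_le_left _ _) hsL
    (by positivity) hc.le hsQ hSc (gain n S (by lia))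

end OneObservation

section Recovery

variable {n m : ℕ} {θ : ℝ} {μ : Measure ℝ} {S : Finset (Fin n)}

theorem sampleProb_mono {E F : Set (Fin m → SpinConfig n)} (h : E ⊆ F) :
    sampleProb θ μ S m E ≤ sampleProb θ μ S m F :=
  sum_le_sum fun x _ ↦ Set.indicator_le_indicator_of_subset h
    (fun _ ↦ prod_nonneg fun _ _ ↦ plantedProb_nonneg _) x

theorem one_sub_sum_plantedMean_pow_le_sampleProb [IsProbabilityMeasure μ] {ι : Type*}
    (T : Finset ι) {F : ι → SpinConfig n → ℝ} (hF : ∀ i σ, 0 ≤ F i σ)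
    {E : Set (Fin m → SpinConfig n)} (hE : ∀ x ∉ E, ∃ i ∈ T, 1 ≤ ∏ r, F i (x r)) :
    1 - ∑ i ∈ T, plantedMean θ μ S (F i) ^ m ≤ sampleProb θ μ S m E := by
  have prob_nonneg (x : Fin m → SpinConfig n) : 0 ≤ ∏ r, plantedProb θ μ S (x r) :=
    prod_nonneg fun r _ ↦ plantedProb_nonneg (x r)
  have term_nonneg (i : ι) (x : Fin m → SpinConfig n) :
      0 ≤ ∏ r, plantedProb θ μ S (x r) * F i (x r) :=
    prod_nonneg fun r _ ↦ mul_nonneg (plantedProb_nonneg _) (hF i _)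
  have pointwise (x : Fin m → SpinConfig n) : ∏ r, plantedProb θ μ S (x r) ≤
      E.indicator (fun y ↦ ∏ r, plantedProb θ μ S (y r)) x +
        ∑ i ∈ T, ∏ r, plantedProb θ μ S (x r) * F i (x r) := by
    by_cases hx : x ∈ E
    · rw [Set.indicator_of_mem hx]
      exact le_add_of_nonneg_right (sum_nonneg fun i _ ↦ term_nonneg i x)
    · obtain ⟨i, hi, one_le⟩ := hE x hx
      rw [Set.indicator_of_notMem hx, zero_add]
      calc _ ≤ (∏ r, plantedProb θ μ S (x r)) * ∏ r, F i (x r) :=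
            le_mul_of_one_le_right (prob_nonneg x) one_le
        _ = ∏ r, plantedProb θ μ S (x r) * F i (x r) := prod_mul_distrib.symm
        _ ≤ _ := single_le_sum (fun j _ ↦ term_nonneg j x) hi
  have summed := sum_le_sum fun x (_ : x ∈ univ) ↦ pointwise x
  rw [sum_add_distrib, sum_comm] at summed
  simp_rw [← Fintype.sum_pow] at summed
  rw [sum_plantedProb, one_pow] at summed
  simpa only [sampleProb, plantedMean, sub_le_iff_le_add, Fintype.sum_pow] using summed

theorem scanStat_eq (k : ℕ) (x : Fin m → SpinConfig n) (S : Finset (Fin n)) :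
    scanStat k x S = 1 / k * (1 / m * ∑ r, totalSpin S (x r) ^ 2 - k) := by
  simp_rw [scanStat, empiricalMoment, ← mul_sum, totalSpin, sq, sum_mul_sum]
  rw [sum_comm (s := univ)]
  simp_rw [sum_comm (s := univ)]

theorem scanStat_le_scanStat_iff {k : ℕ} (hk : 0 < k) (hm : 0 < m) (x : Fin m → SpinConfig n)
    (S S' : Finset (Fin n)) : scanStat k x S ≤ scanStat k x S' ↔
      ∑ r, totalSpin S (x r) ^ 2 ≤ ∑ r, totalSpin S' (x r) ^ 2 := by
  rw [scanStat_eq, scanStat_eq, mul_le_mul_iff_right₀ (by positivity), sub_le_sub_iff_right,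
    mul_le_mul_iff_right₀ (by positivity)]

theorem sum_pow_card_symmDiff_le (S : Finset (Fin n)) {y : ℝ} (hy : 0 ≤ y) :
    ∑ S' ∈ univ.erase S, y ^ #(symmDiff S S') ≤ Real.exp (n * y) - 1 := by
  have sum_erase : 1 + ∑ S' ∈ univ.erase S, y ^ #(symmDiff S S') =
      ∑ S', y ^ #(symmDiff S S') := by
    rw [← add_sum_erase univ _ (mem_univ S)]
    simp
  have sum_univ_le : ∑ S', y ^ #(symmDiff S S') ≤ Real.exp (n * y) := calc
    _ = ∑ U : Finset (Fin n), y ^ #U :=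
      Fintype.sum_equiv (.mk (symmDiff S) (symmDiff S) (symmDiff_symmDiff_cancel_left S)
        (symmDiff_symmDiff_cancel_left S)) _ _ fun _ ↦ rfl
    _ = (y + 1) ^ n := by simpa using Fintype.sum_pow_mul_eq_add_pow (Fin n) y 1
    _ ≤ Real.exp y ^ n := by gcongr; exact Real.add_one_le_exp y
    _ = _ := (Real.exp_nat_mul y n).symm
  linarith

theorem card_symmDiff_eq_two_mul {α : Type*} [DecidableEq α] {S S' : Finset α} (h : #S' = #S) :
    #(symmDiff S S') = 2 * #(S' \ S) := by
  rw [symmDiff_def, sup_eq_union, card_union_of_disjoint disjoint_sdiff_sdiff,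
    card_sdiff_comm h.symm, two_mul]

theorem one_sub_le_sampleProb_forall_isScanMaximizer_eq [IsProbabilityMeasure μ]
    (hS : S.Nonempty) (hm : 0 < m) {s c : ℝ} (hs : 0 < s)
    (hexp : ∀ S' : Finset (Fin n), #S' = #S → plantedMean θ μ S (fun σ ↦
      Real.exp (s / #S * (totalSpin S' σ ^ 2 - totalSpin S σ ^ 2))) ≤
        Real.exp (-(c * (#(S' \ S) / #S)))) :
    1 - (Real.exp (n * Real.exp (-(c * m / (2 * #S)))) - 1) ≤
      sampleProb θ μ S m {x | ∀ S', IsScanMaximizer #S x S' → S' = S} := by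
  classical
  let F (S' : Finset (Fin n)) (σ : SpinConfig n) : ℝ :=
    Real.exp (s / #S * (totalSpin S' σ ^ 2 - totalSpin S σ ^ 2))
  let rivals := (univ.erase S).filter fun S' : Finset (Fin n) ↦ #S' = #S
  have rival_wins (x : Fin m → SpinConfig n)
      (hx : x ∉ {x | ∀ S', IsScanMaximizer #S x S' → S' = S}) :
      ∃ S' ∈ rivals, 1 ≤ ∏ r, F S' (x r) := by
    simp only [Set.mem_ofPred_eq, not_forall] at hx
    obtain ⟨S', hmax, hne⟩ := hx
    refine ⟨S', by simp [rivals, hne, hmax.1], ?_⟩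
    rw [← Real.exp_sum, ← mul_sum, sum_sub_distrib]
    exact Real.one_le_exp (mul_nonneg (by positivity)
      (sub_nonneg.2 ((scanStat_le_scanStat_iff hS.card_pos hm x S S').1 (hmax.2 S rfl))))
  have rival_pow_le : ∀ S' ∈ rivals, plantedMean θ μ S (F S') ^ m ≤
      Real.exp (-(c * m / (2 * #S))) ^ #(symmDiff S S') := fun S' hS' ↦ by
    have hcard : #S' = #S := (mem_filter.1 hS').2
    have mean_nonneg : 0 ≤ plantedMean θ μ S (F S') :=
      sum_nonneg fun σ _ ↦ mul_nonneg (plantedProb_nonneg σ) (Real.exp_nonneg _)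
    refine (pow_le_pow_left₀ mean_nonneg (hexp S' hcard) m).trans_eq ?_
    rw [card_symmDiff_eq_two_mul hcard, ← Real.exp_nat_mul, ← Real.exp_nat_mul]
    push_cast
    field_simp
  have rivals_sum_le : ∑ S' ∈ rivals, plantedMean θ μ S (F S') ^ m ≤
      Real.exp (n * Real.exp (-(c * m / (2 * #S)))) - 1 := calc
    _ ≤ ∑ S' ∈ rivals, Real.exp (-(c * m / (2 * #S))) ^ #(symmDiff S S') :=
      sum_le_sum rival_pow_le
    _ ≤ ∑ S' ∈ univ.erase S, Real.exp (-(c * m / (2 * #S))) ^ #(symmDiff S S') :=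
      sum_le_sum_of_subset_of_nonneg (filter_subset _ _) fun _ _ _ ↦ by positivity
    _ ≤ _ := sum_pow_card_symmDiff_le S (Real.exp_nonneg _)
  exact (sub_le_sub_left rivals_sum_le 1).trans
    (one_sub_sum_plantedMean_pow_le_sampleProb rivals (fun _ _ ↦ Real.exp_nonneg _) rival_wins)

theorem exp_mul_exp_neg_sub_one_le {x y : ℝ} (hx : 1 ≤ x) (hy : 2 * Real.log x ≤ y) :
    Real.exp (x * Real.exp (-y)) - 1 ≤ 2 / x := by
  have x_pos : 0 < x := by positivity
  have mul_exp_le : x * Real.exp (-y) ≤ 1 / x := calc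
    _ ≤ x * Real.exp (-(2 * Real.log x)) := by gcongr
    _ = 1 / x := by
      rw [← Real.log_rpow x_pos, ← Real.log_inv, Real.exp_log (by positivity)]
      norm_num
      field_simp
  have abs_le_one : |1 / x| ≤ 1 := by
    rwa [abs_of_pos (by positivity), div_le_one x_pos]
  calc _ ≤ Real.exp (1 / x) - 1 := by gcongr
    _ ≤ 2 * |1 / x| := (le_abs_self _).trans (Real.abs_exp_sub_one_le abs_le_one)
    _ = 2 / x := by rw [abs_of_pos (by positivity), mul_one_div]

end Recovery

theorem mainTheorem9_general (μ : Measure ℝ) [IsProbabilityMeasure μ]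
    (hμ : μ.map (fun x : ℝ ↦ -x) = μ) (θ : ℝ) (hθ : 0 < θ) :
    ∃ C : ℝ, 0 < C ∧ ∀ δ : ℝ, 0 < δ → ∃ K : ℕ, ∀ n k m : ℕ, K ≤ k → C * k * Real.log n ≤ m →
      ∀ S₀ : Finset (Fin n), #S₀ = k →
        1 - δ ≤ sampleProb θ μ S₀ m {x | ∀ S, IsScanMaximizer k x S → S = S₀} := by
  obtain ⟨s, c, K, hs, hc, one_observation⟩ := exists_plantedMean_exp_sq_totalSpin_sub_le hμ hθ
  refine ⟨4 / c, by positivity, fun δ hδ ↦ ⟨K + ⌈2 / δ⌉₊ + 2, ?_⟩⟩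
  rintro n _ m hk hm S₀ rfl
  have card_le : #S₀ ≤ n := by simpa using card_le_univ S₀
  have card_S₀_pos : 0 < #S₀ := by lia
  have one_lt_n : (1 : ℝ) < n := by exact_mod_cast (by lia : 1 < n)
  have log_pos : 0 < Real.log n := Real.log_pos one_lt_n
  have m_pos : 0 < m := by
    exact_mod_cast (show (0 : ℝ) < 4 / c * #S₀ * Real.log n by positivity).trans_le hm
  have two_mul_log_le : 2 * Real.log n ≤ c * m / (2 * #S₀) := by
    rw [le_div_iff₀ (by positivity)]
    calc 2 * Real.log n * (2 * #S₀) = c * (4 / c * #S₀ * Real.log n) := by field_simp; ring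
      _ ≤ c * m := by gcongr
  have two_div_le : 2 / (n : ℝ) ≤ δ := (div_le_comm₀ hδ (by positivity)).1 <|
    (Nat.le_ceil _).trans (by exact_mod_cast (by lia : ⌈2 / δ⌉₊ ≤ n))
  calc 1 - δ ≤ 1 - (Real.exp (n * Real.exp (-(c * m / (2 * #S₀)))) - 1) :=
        sub_le_sub_left ((exp_mul_exp_neg_sub_one_le one_lt_n.le two_mul_log_le).trans two_div_le) 1
    _ ≤ _ := one_sub_le_sampleProb_forall_isScanMaximizer_eq (card_pos.1 card_S₀_pos) m_pos hs
        fun S' ↦ one_observation n S₀ S' (by lia)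

theorem mainTheorem9 (μ : MeasureTheory.Measure ℝ) [MeasureTheory.IsProbabilityMeasure μ]
    (hμ : μ.map (fun x : ℝ => -x) = μ) (θ : ℝ) (hθ : 0 < θ)
    (hhigh : θ < 1 / ∫ x : ℝ, 1 / Real.cosh x ^ 2 ∂μ) :
    ∃ C : ℝ, 0 < C ∧ ∀ ε : ℝ, 0 < ε → ∀ δ : ℝ, 0 < δ → ∃ K : ℕ,
      ∀ n k m : ℕ, K ≤ k → C * (k : ℝ) * Real.log (n : ℝ) ≤ (m : ℝ) →
        ∀ S₀ : Finset (Fin n), S₀.card = k →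
          1 - δ ≤ sampleProb θ μ S₀ m
            {x | ∀ S : Finset (Fin n), IsScanMaximizer k x S →
              ((symmDiff S₀ S).card : ℝ) ≤ ε * (k : ℝ)} := by
  obtain ⟨C, hC, recovery⟩ := mainTheorem9_general μ hμ θ hθ
  refine ⟨C, hC, fun ε hε δ hδ ↦ ?_⟩
  obtain ⟨K, hK⟩ := recovery δ hδ
  refine ⟨K, fun n k m hk hm S₀ hS₀ ↦ (hK n k m hk hm S₀ hS₀).trans (sampleProb_mono ?_)⟩
  intro x hx S hS
  simpa [hx S hS] using by positivity
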